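/- Let $(M^n,g)$ be a connected smooth Riemannian manifold without boundary, and let $\nabla$ be a smooth connection on $TM$ which is metric ($\nabla g=0$) and flat (its curvature vanishes), and whose torsion, viewed as the $(3,0)$-tensor $$T(X,Y,Z)=g(T(X,Y),Z),\qquad T(X,Y)=\nabla_XY-\nabla_YX-[X,Y],$$ is antisymmetric in all arguments, i.e. $T\in\Lambda^3(M)$. Define the $4$-form $$\sigma_T(X,Y,Z,V)=\langle T(X,Y),T(Z,V)\rangle+\langle T(Y,Z),T(X,V)\rangle+\langle T(Z,X),T(Y,V)\rangle ,$$ let $\nabla^g$ be the Levi-Civita connection and let $\nabla^{1/3}$ be the metric connection with torsion $\tfrac13T$ (both exist and are smooth). Let $$\mathcal R^g(X,Y,Z,V)=g\big(\nabla^g_X\nabla^g_YZ-\nabla^g_Y\nabla^g_XZ-\nabla^g_{[X,Y]}Z,\;V\big)$$ be the Riemann curvature tensor, so that the scalar curvature is $\sum_{i,j}\mathcal R^g(e_i,e_j,e_j,e_i)$ for an orthonormal basis $(e_i)$ of the tangent space, and the sectional curvature of the plane spanned by linearly independent $X,Y$ is $K(X,Y)=\mathcal R^g(X,Y,Y,X)/(\|X\|^2\|Y\|^2-\langle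 X,Y\rangle^2)$. Write $\|T\|^2=\sum_{i<j<k}T(e_i,e_j,e_k)^2$, and let $V\lrcorner$ denote insertion of $V$ into the first slot. Then: 1. $3\,dT=2\,\sigma_T$, $\;\nabla^{1/3}T=0$ and $\nabla^{1/3}\sigma_T=0$. 2. The covariant derivative $\nabla T$ is a $4$-form (totally antisymmetric), and $$(\nabla_VT)(X,Y,Z)=\tfrac13\,\sigma_T(X,Y,Z,V),\quad\text{i.e. } \nabla_VT=-\tfrac13\,(V\lrcorner\sigma_T),$$ $$(\nabla^g_VT)(X,Y,Z)=-\tfrac16\,\sigma_T(X,Y,Z,V),\quad\text{i.e. } \nabla^g_VT=\tfrac16\,(V\lrcorner\sigma_T).$$ 3. The length $\|T\|$ and the scalar curvature of $g$ are constant on $M$. 4. The Riemann curvature tensor is $$\mathcal R^g(X,Y,Z,V)=-\tfrac16\langle T(X,Y),T(Z,V)\rangle+\tfrac1{12}\langle T(Y,Z),T(X,V)\rangle+\tfrac1{12}\langle T(Z,X),T(Y,V)\rangle ,$$ and it is $\nabla^{1/3}$-parallel, $\nabla^{1/3}\mathcal R^g=0$. 5. The sectional curvature is non-negative: for linearly independent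 tangent vectors $X,Y$ at a point, $$K(X,Y)=\frac{\|T(X,Y)\|^2}{4\,[\|X\|^2\|Y\|^2-\langle X,Y\rangle^2]}\;\ge\;0 .$$ -/

import Mathlib

open Bundle Manifold
open scoped ContDiff

noncomputable section

namespace FlatTorsion

variable {E : Type*} [NormedAddCommGroup E] [NormedSpace ℝ E]
  {H : Type*} [TopologicalSpace H] {I : ModelWithCorners ℝ E H}
  {M : Type*} [TopologicalSpace M] [ChartedSpace H M] [IsManifold I ∞ M]

/-- The vector field `X` on `M` is smooth. -/
def IsSmoothField (X : Π x : M, TangentSpace I x) : Prop :=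
  ContMDiff I I.tangent ∞ (fun x ↦ (⟨x, X x⟩ : TangentBundle I M))

/-- Fields of real valued functions of `k` tangent vectors. All covariant `k`-tensor fields and
`k`-forms below are of this shape. -/
abbrev TensorField (I : ModelWithCorners ℝ E H) (M : Type*) [TopologicalSpace M]
    [ChartedSpace H M] (k : ℕ) : Type _ :=
  Π x : M, (Fin k → TangentSpace I x) → ℝ

/-- The interior product `V ⌟ A`, which inserts `V` into the first slot of `A`. -/
def interiorProduct {k : ℕ} (V : Π x : M, TangentSpace I x) (A : TensorField I M (k + 1)) :
    TensorField I M k :=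
  fun x w ↦ A x (Matrix.vecCons (V x) w)

/-- The covariant derivative `(∇_V A)(X_1, …, X_k)
= V (A(X_1, …, X_k)) - ∑ᵢ A(X_1, …, ∇_V X_i, …, X_k)` of a covariant tensor field, evaluated on
vector fields. -/
def covDeriv {k : ℕ} (cov : CovariantDerivative I E (TangentSpace I : M → Type _))
    (A : TensorField I M k) (V : Π x : M, TangentSpace I x)
    (X : Fin k → Π x : M, TangentSpace I x) (x : M) : ℝ :=
  mvfderiv I (fun y ↦ A y (fun i ↦ X i y)) x (V x)
    - ∑ i, A x (Function.update (fun j ↦ X j x) i (cov (X i) x (V x)))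

/-- `∇ A = 0`. -/
def IsParallel {k : ℕ}
    (cov : CovariantDerivative I E (TangentSpace I : M → Type _)) (A : TensorField I M k) : Prop :=
  ∀ (V : Π x : M, TangentSpace I x) (X : Fin k → Π x : M, TangentSpace I x),
    IsSmoothField V → (∀ i, IsSmoothField (X i)) → ∀ x, covDeriv cov A V X x = 0

/-- The exterior derivative of a form, evaluated on vector fields:
`dω(V_0, …, V_n) = ∑ᵢ (-1)^i V_i(ω(…, V̂_i, …)) + ∑_{i < j} (-1)^{i+j} ω([V_i, V_j], …, V̂_i, …, V̂_j, …)`.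
The pair `i < j` is encoded as `(i.castSucc, j.succ)` with `i ≤ j`, which changes the parity of
`i + j`. -/
def extDerivForm {k : ℕ} (A : TensorField I M (k + 1))
    (V : Fin (k + 2) → Π x : M, TangentSpace I x) (x : M) : ℝ :=
  (∑ i, (-1) ^ i.val *
      mvfderiv I (fun y ↦ A y (i.removeNth (fun m ↦ V m y))) x (V i x)) -
    ∑ i : Fin (k + 1), ∑ j ≥ i, (-1) ^ (i.val + j.val) *
      A x (Matrix.vecCons (VectorField.mlieBracket I (V i.castSucc) (V j.succ) x)
        (j.removeNth (i.castSucc.removeNth (fun m ↦ V m x))))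

/-- The curvature `R(X, Y) Z = ∇_X ∇_Y Z - ∇_Y ∇_X Z - ∇_{[X, Y]} Z`. -/
def curvature (cov : CovariantDerivative I E (TangentSpace I : M → Type _))
    (X Y Z : Π x : M, TangentSpace I x) (x : M) : TangentSpace I x :=
  cov (fun y ↦ cov Z y (Y y)) x (X x) - cov (fun y ↦ cov Z y (X y)) x (Y x)
    - cov Z x (VectorField.mlieBracket I X Y x)

/-- The connection has vanishing curvature. -/
def IsFlat
    (cov : CovariantDerivative I E (TangentSpace I : M → Type _)) : Prop :=
  ∀ X Y Z : Π x : M, TangentSpace I x, IsSmoothField X → IsSmoothField Y → IsSmoothField Z →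
    ∀ x, curvature cov X Y Z x = 0

variable [FiniteDimensional ℝ E] [RiemannianBundle (fun x : M ↦ TangentSpace I x)]

/-- The curvature as a `(4,0)`-tensor, `R(u, v, w, z) = g(R(u, v) w, z)`, on tangent vectors at `x`.
The tangent vectors are extended to vector fields that are smooth near `x`; for a smooth connection
the value does not depend on the extensions. -/
def curvatureTensor (cov : CovariantDerivative I E (TangentSpace I : M → Type _)) :
    TensorField I M 4 :=
  fun x w ↦ inner ℝ (curvature cov (FiberBundle.extend E (w 0)) (FiberBundle.extend E (w 1))
    (FiberBundle.extend E (w 2)) x) (w 3)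

/-- The torsion as a `(3,0)`-tensor, `T(X, Y, Z) = g(T(X, Y), Z)`. -/
def torsionForm (cov : CovariantDerivative I E (TangentSpace I : M → Type _)) :
    TensorField I M 3 :=
  fun x w ↦ inner ℝ (cov.torsion x (w 0) (w 1)) (w 2)

/-- The torsion, viewed as a `(3,0)`-tensor, is antisymmetric in all its arguments. -/
def HasSkewTorsion (cov : CovariantDerivative I E (TangentSpace I : M → Type _)) : Prop :=
  ∀ (x : M) (w : Fin 3 → TangentSpace I x) (τ : Equiv.Perm (Fin 3)),
    torsionForm cov x (w ∘ τ) = (Equiv.Perm.sign τ : ℝ) * torsionForm cov x w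

/-- `σ_T(X, Y, Z, V) = ⟨T(X,Y), T(Z,V)⟩ + ⟨T(Y,Z), T(X,V)⟩ + ⟨T(Z,X), T(Y,V)⟩`. -/
def sigmaForm (cov : CovariantDerivative I E (TangentSpace I : M → Type _)) :
    TensorField I M 4 :=
  fun x w ↦ inner ℝ (cov.torsion x (w 0) (w 1)) (cov.torsion x (w 2) (w 3))
    + inner ℝ (cov.torsion x (w 1) (w 2)) (cov.torsion x (w 0) (w 3))
    + inner ℝ (cov.torsion x (w 2) (w 0)) (cov.torsion x (w 1) (w 3))

/-- The tangent spaces are finite dimensional, which provides orthonormal bases. -/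
instance finiteDimensional_tangentSpace (x : M) : FiniteDimensional ℝ (TangentSpace I x) :=
  inferInstanceAs (FiniteDimensional ℝ E)

/-- An orthonormal basis of the tangent space at `x`. -/
def orthoBasis (I : ModelWithCorners ℝ E H) [IsManifold I ∞ M]
    [RiemannianBundle (fun x : M ↦ TangentSpace I x)] (x : M) :
    OrthonormalBasis (Fin (Module.finrank ℝ (TangentSpace I x))) ℝ (TangentSpace I x) :=
  stdOrthonormalBasis ℝ (TangentSpace I x)

/-- The norm of a `3`-form `A` at `x`: `‖A‖² = ∑_{i < j < k} A(e_i, e_j, e_k)²`, that is, one sixth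
of the sum over all `i, j, k`, where `e_i` is an orthonormal basis (the choice does not matter). -/
def threeFormNorm (A : TensorField I M 3) (x : M) : ℝ :=
  Real.sqrt ((1 / 6) * ∑ i, ∑ j, ∑ k,
    A x ![orthoBasis I x i, orthoBasis I x j, orthoBasis I x k] ^ 2)

/-- The scalar curvature `∑_{i,j} R(e_i, e_j, e_j, e_i)`, where `e_i` is an orthonormal basis
(the choice does not matter). -/
def scalarCurvature (cov : CovariantDerivative I E (TangentSpace I : M → Type _)) (x : M) : ℝ :=
  ∑ i, ∑ j, curvatureTensor cov x
    ![orthoBasis I x i, orthoBasis I x j, orthoBasis I x j, orthoBasis I x i]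

/-- The sectional curvature `K(u, v) = R(u, v, v, u) / (‖u‖² ‖v‖² - ⟨u, v⟩²)` of the plane spanned
by linearly independent tangent vectors `u`, `v`. -/
def sectionalCurvature (cov : CovariantDerivative I E (TangentSpace I : M → Type _)) (x : M)
    (u v : TangentSpace I x) : ℝ :=
  curvatureTensor cov x ![u, v, v, u] / (‖u‖ ^ 2 * ‖v‖ ^ 2 - inner ℝ u v ^ 2)

/-- The connection is metric: `V g(X, Y) = g(∇_V X, Y) + g(X, ∇_V Y)`. -/
def IsMetric (cov : CovariantDerivative I E (TangentSpace I : M → Type _)) : Prop :=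
  ∀ V X Y : Π x : M, TangentSpace I x, IsSmoothField V → IsSmoothField X → IsSmoothField Y →
    ∀ x, mvfderiv I (fun y ↦ (inner ℝ (X y) (Y y) : ℝ)) x (V x)
      = inner ℝ (cov X x (V x)) (Y x) + inner ℝ (X x) (cov Y x (V x))

/-- `cov` is the Levi-Civita connection: it is metric and torsion free. -/
def IsLeviCivita (cov : CovariantDerivative I E (TangentSpace I : M → Type _)) : Prop :=
  IsMetric cov ∧ ∀ x, cov.torsion x = 0

/-- `cov'` is the metric connection with torsion `s T`, where `T` is the torsion of `cov`. -/
def IsMetricWithScaledTorsion (s : ℝ)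
    (cov cov' : CovariantDerivative I E (TangentSpace I : M → Type _)) : Prop :=
  IsMetric cov' ∧ ∀ x, cov'.torsion x = s • cov.torsion x

end FlatTorsion

end

open FlatTorsion

/-!
A flat metric connection `∇` with totally skew torsion `T` is controlled by a single algebraic
object, the `4`-form `σ_T`, and all claims reduce to identities between scalar products of values
of `T`.

The first Bianchi identity of a flat connection (`IsFlat.bianchi`, a consequence of the Jacobi
identity for vector fields) says that the cyclic sum of `(∇_X T)(Y, Z)` equals minus the cyclic sum
of `T(T(X, Y), Z)`, that is, `-σ_T` after pairing with a fourth field. As `∇` is metric, `∇T` is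
skew in its last three arguments. The four instances of the Bianchi identity on four fields then
form a linear system whose solution is `(∇_V T)(X, Y, Z) = σ_T(X, Y, Z, V) / 3`
(`IsFlat.inner_covDerivTorsion`). Expanding `dT` in terms of `∇` and `T` turns this into
`3 dT = 2 σ_T` (`extDerivForm_torsionForm`).

By the Koszul argument, the metric connection with torsion `s T` is `∇ + c T` with `c = (s - 1) / 2`
(`IsMetricWithScaledTorsion.isTorsionShift`, `exists_isMetricWithScaledTorsion`): the Levi-Civita
connection is `c = -1/2` and `∇^{1/3}` is `c = -1/3`. Adding `c T` changes the covariant derivative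
of `T` by `c σ_T`, so that the derivative is `(1/3 + c) σ_T`
(`IsTorsionShift.covDeriv_torsionForm`). It vanishes for `∇^{1/3}`, and hence every tensor built
from `T` and the metric is `∇^{1/3}`-parallel (`isParallel_torsionQuadratic`). In the curvature of
`∇ + c T` the curvature of `∇` drops out, and the terms linear in `c` assemble into `∇T`; the result
is an explicit quadratic expression in `T` (`IsTorsionShift.inner_curvature`), whose value at
`c = -1/2` is the Riemann tensor. On a plane it reduces to `‖T(u, v)‖² / 4`, which gives the
sectional curvature, and its double trace is a multiple of `‖T‖²`.

Finally `‖T‖²` is constant since `T` is parallel for a metric connection: computed in a smooth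
orthonormal frame, its derivative only involves the infinitesimal rotation of the frame, under which
the norm is invariant (`hasMFDerivAt_torsionNormSq`).

Covariant derivatives and torsion are evaluated on globally smooth vector fields throughout. Bump
functions produce such fields with prescribed values, or with a prescribed germ
(`exists_isSmoothField_eventuallyEq`), which passes from fields to tangent vectors; this is also why
the Hausdorff assumption enters.
-/

namespace FlatTorsion

open Filter Topology

/-! ### Smooth vector fields: globalization and constancy of functions -/

section Globalization

variable {E : Type*} [NormedAddCommGroup E] [NormedSpace ℝ E]
  {H : Type*} [TopologicalSpace H] {I : ModelWithCorners ℝ E H}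
  {M : Type*} [TopologicalSpace M] [ChartedSpace H M] [IsManifold I ∞ M]

theorem IsSmoothField.mdifferentiableAt {X : Π x : M, TangentSpace I x} (hX : IsSmoothField X)
    (x : M) : MDiffAt (T% X) x :=
  (hX x).mdifferentiableAt (by simp)

theorem IsSmoothField.add {X Y : Π x : M, TangentSpace I x} (hX : IsSmoothField X)
    (hY : IsSmoothField Y) : IsSmoothField (X + Y) :=
  ContMDiff.add_section hX hY

theorem IsSmoothField.sub {X Y : Π x : M, TangentSpace I x} (hX : IsSmoothField X)
    (hY : IsSmoothField Y) : IsSmoothField (X - Y) :=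
  ContMDiff.sub_section hX hY

theorem IsSmoothField.const_smul {X : Π x : M, TangentSpace I x} (hX : IsSmoothField X)
    (c : ℝ) : IsSmoothField (c • X) :=
  ContMDiff.const_smul_section hX

variable [FiniteDimensional ℝ E]

theorem IsSmoothField.mlieBracket {X Y : Π x : M, TangentSpace I x} (hX : IsSmoothField X)
    (hY : IsSmoothField Y) : IsSmoothField (VectorField.mlieBracket I X Y) := by
  have : IsManifold I ((⊤ : ℕ∞) + 1 : ℕ∞ω) M := by
    change IsManifold I ∞ M
    infer_instance
  have : IsManifold I (minSmoothness ℝ 2) M := by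
    rw [minSmoothness_of_isRCLikeNormedField]
    infer_instance
  exact ContDiff.mlieBracket_vectorField (m := ⊤) (n := ⊤) hX hY (by simp)

/-- A field which is smooth near a point agrees near that point with a globally smooth field. -/
theorem exists_isSmoothField_eventuallyEq [T2Space M] {X : Π x : M, TangentSpace I x} {x : M}
    {s : Set M} (hs : s ∈ 𝓝 x) (hX : CMDiff[s] ∞ (T% X)) :
    ∃ X' : Π x : M, TangentSpace I x, IsSmoothField X' ∧ ∀ᶠ y in 𝓝 x, X y = X' y := by
  obtain ⟨u, hus, hu, hxu⟩ := mem_nhds_iff.1 hs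
  obtain ⟨f, hf, -⟩ := (SmoothBumpFunction.nhds_basis_support (I := I) (hu.mem_nhds hxu)).mem_iff.1
    (hu.mem_nhds hxu)
  refine ⟨(f : M → ℝ) • X,
    ContMDiffOn.smul_section_of_tsupport f.contMDiff.contMDiffOn hu hf (hX.mono hus), ?_⟩
  filter_upwards [f.eventuallyEq_one] with y hy
  simp [hy]

theorem exists_isSmoothField_eventuallyEq_extend [T2Space M] {x : M} (v : TangentSpace I x) :
    ∃ X : Π x : M, TangentSpace I x, IsSmoothField X ∧
      ∀ᶠ y in 𝓝 x, FiberBundle.extend E v y = X y := by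
  obtain ⟨s, hs, h⟩ := FiberBundle.exists_contMDiffOn_extend (k := ∞) I E v
  exact exists_isSmoothField_eventuallyEq hs h

theorem exists_isSmoothField_apply_eq [T2Space M] {x : M} (v : TangentSpace I x) :
    ∃ X : Π x : M, TangentSpace I x, IsSmoothField X ∧ X x = v := by
  obtain ⟨X, hX, h⟩ := exists_isSmoothField_eventuallyEq_extend v
  exact ⟨X, hX, by simpa using h.self_of_nhds.symm⟩

/-- A field of endomorphisms which maps smooth vector fields to smooth vector fields is smooth. -/
theorem contMDiff_hom_of_isSmoothField [T2Space M]
    (Φ : Π x : M, TangentSpace I x →L[ℝ] TangentSpace I x)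
    (h : ∀ X : Π x : M, TangentSpace I x, IsSmoothField X → IsSmoothField (fun x ↦ Φ x (X x))) :
    ContMDiff I (I.prod 𝓘(ℝ, E →L[ℝ] E)) ∞ (fun x ↦
      (⟨x, Φ x⟩ : TotalSpace (E →L[ℝ] E) fun x : M ↦ TangentSpace I x →L[ℝ] TangentSpace I x)) := by
  intro x₀
  rw [contMDiffAt_hom_bundle]
  refine ⟨contMDiffAt_id, ?_⟩
  let t := trivializationAt E (TangentSpace I : M → Type _) x₀
  have hx₀ : x₀ ∈ t.baseSet := FiberBundle.mem_baseSet_trivializationAt E _ x₀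
  let b := Module.finBasis ℝ E
  -- a linear map on `E` is the sum of the rank one maps `w ↦ bⁱ(w) L(bᵢ)`
  have hdec : ∀ L : E →L[ℝ] E, L = ∑ i,
      ContinuousLinearMap.smulRightL ℝ E E (LinearMap.toContinuousLinearMap (b.coord i))
        (L (b i)) := by
    intro L
    ext w
    conv_lhs => rw [← b.sum_repr w, map_sum]
    simp
  have hkey : ∀ i, ContMDiffAt I 𝓘(ℝ, E) ∞ (fun y ↦
      ContinuousLinearMap.inCoordinates E (TangentSpace I : M → Type _) E
        (TangentSpace I : M → Type _) x₀ y x₀ y (Φ y) (b i)) x₀ := by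
    intro i
    have hloc : CMDiff[t.baseSet] ∞ (T% (fun y ↦ t.symmL ℝ y (b i) : Π y : M, TangentSpace I y)) := by
      have := (t.contMDiffOn_localFrame_baseSet (I := I) ∞ b i)
      refine this.congr fun y hy ↦ ?_
      simp [Trivialization.localFrame_apply_of_mem_baseSet, hy, Trivialization.basisAt,
        Trivialization.symmL_apply]
    obtain ⟨X, hX, hXe⟩ := exists_isSmoothField_eventuallyEq (t.open_baseSet.mem_nhds hx₀) hloc
    have h1 := (t.contMDiffAt_section_iff hx₀).1 ((h X hX) x₀)
    refine h1.congr_of_eventuallyEq ?_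
    filter_upwards [hXe, t.open_baseSet.mem_nhds hx₀] with y hy hyb
    rw [ContinuousLinearMap.inCoordinates_eq hyb hyb]
    simp only [ContinuousLinearMap.coe_comp, Function.comp_apply]
    rw [Trivialization.symmL_apply _ hyb] at hy
    rw [← hy]
    simp [t]
  have : (fun y ↦ ContinuousLinearMap.inCoordinates E (TangentSpace I : M → Type _) E
        (TangentSpace I : M → Type _) x₀ y x₀ y (Φ y)) = fun y ↦ ∑ i,
      ContinuousLinearMap.smulRightL ℝ E E (LinearMap.toContinuousLinearMap (b.coord i))
        (ContinuousLinearMap.inCoordinates E (TangentSpace I : M → Type _) E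
        (TangentSpace I : M → Type _) x₀ y x₀ y (Φ y) (b i)) := by
    funext y
    exact hdec _
  rw [this]
  refine ContMDiffAt.sum fun i _ ↦ ?_
  exact (ContinuousLinearMap.contMDiffAt _).comp x₀ (hkey i)

end Globalization

section ConstantFunctions

variable {E : Type*} [NormedAddCommGroup E] [NormedSpace ℝ E]
  {H : Type*} [TopologicalSpace H] {I : ModelWithCorners ℝ E H}
  {M : Type*} [TopologicalSpace M] [ChartedSpace H M]

theorem mvfderiv_sum {ι : Type*} (s : Finset ι) {f : ι → M → ℝ} {x : M}
    (hf : ∀ i ∈ s, MDiffAt (f i) x) :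
    MDiffAt (fun y ↦ ∑ i ∈ s, f i y) x ∧
      mvfderiv I (fun y ↦ ∑ i ∈ s, f i y) x = ∑ i ∈ s, mvfderiv I (f i) x := by
  classical
  induction s using Finset.induction_on with
  | empty => simp [mdifferentiableAt_const, mvfderiv_const]
  | insert a s ha ih =>
    simp only [Finset.mem_insert, forall_eq_or_imp] at hf
    obtain ⟨h1, h2⟩ := ih hf.2
    simp only [Finset.sum_insert ha]
    exact ⟨hf.1.add h1, by rw [mvfderiv_fun_add hf.1 h1, h2]⟩

/-- On a connected manifold without boundary, a differentiable function with zero derivative is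
constant. -/
theorem eq_of_hasMFDerivAt_zero [IsManifold I ∞ M] [I.Boundaryless] [PreconnectedSpace M] {f : M → ℝ}
    (hf : ∀ x, HasMFDerivAt I 𝓘(ℝ, ℝ) f x (0 : TangentSpace I x →L[ℝ] ℝ)) (x y : M) :
    f x = f y := by
  suffices IsLocallyConstant f from this.apply_eq_of_preconnectedSpace x y
  rw [IsLocallyConstant.iff_eventually_eq]
  intro x
  let e := extChartAt I x
  let g : E → ℝ := f ∘ e.symm
  have htarget : IsOpen e.target := isOpen_extChartAt_target x
  have hd : ∀ z ∈ e.target, HasFDerivAt g (0 : E →L[ℝ] ℝ) z := by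
    intro z hz
    have h1 : MDifferentiableAt 𝓘(ℝ, E) I e.symm z :=
      ((contMDiffOn_extChartAt_symm (n := 1) x).contMDiffAt
        (htarget.mem_nhds hz)).mdifferentiableAt (by simp)
    have h2 := ((hf (e.symm z)).comp z h1.hasMFDerivAt).hasFDerivAt
    exact h2.congr_fderiv (by ext; rfl)
  obtain ⟨r, hr, hball⟩ := Metric.isOpen_iff.1 htarget (e x) (mem_extChartAt_target x)
  have hconst : ∀ z ∈ Metric.ball (e x) r, g z = g (e x) := by
    intro z hz
    refine Metric.isOpen_ball.is_const_of_fderiv_eq_zero (𝕜 := ℝ)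
      (convex_ball _ _).isPreconnected (fun w hw ↦
      (hd w (hball hw)).differentiableAt.differentiableWithinAt) (fun w hw ↦
      (hd w (hball hw)).fderiv) hz (Metric.mem_ball_self hr)
  have hcont : e ⁻¹' Metric.ball (e x) r ∈ 𝓝 x :=
    (continuousAt_extChartAt x).preimage_mem_nhds (Metric.ball_mem_nhds _ hr)
  filter_upwards [hcont, extChartAt_source_mem_nhds (I := I) x] with y hy hys
  have := hconst (e y) hy
  simpa only [g, Function.comp_apply, e, extChartAt_to_inv, (extChartAt I x).left_inv hys]
    using this

end ConstantFunctions

/-! ### Smooth orthonormal frames -/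

section Frames

variable {E : Type*} [NormedAddCommGroup E] [NormedSpace ℝ E]
  {H : Type*} [TopologicalSpace H] {I : ModelWithCorners ℝ E H}
  {M : Type*} [TopologicalSpace M] [ChartedSpace H M] [IsManifold I ∞ M]
  [RiemannianBundle (fun x : M ↦ TangentSpace I x)]
  [IsContMDiffRiemannianBundle I ∞ E (fun x : M ↦ TangentSpace I x)]

theorem IsSmoothField.contMDiff_inner {X Y : Π x : M, TangentSpace I x}
    (hX : IsSmoothField X) (hY : IsSmoothField Y) :
    ContMDiff I 𝓘(ℝ, ℝ) ∞ (fun y ↦ (inner ℝ (X y) (Y y) : ℝ)) :=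
  ContMDiff.inner_bundle hX hY

theorem IsSmoothField.mdifferentiableAt_inner {X Y : Π x : M, TangentSpace I x}
    (hX : IsSmoothField X) (hY : IsSmoothField Y) (x : M) :
    MDiffAt (fun y ↦ (inner ℝ (X y) (Y y) : ℝ)) x :=
  (hX.contMDiff_inner hY x).mdifferentiableAt (by simp)

theorem contMDiffOn_gramSchmidt {n : ℕ} {f : Fin n → Π x : M, TangentSpace I x} {u : Set M}
    (hf : ∀ i, CMDiff[u] ∞ (T% (f i))) (hli : ∀ y ∈ u, LinearIndependent ℝ (fun i ↦ f i y))
    (i : Fin n) :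
    CMDiff[u] ∞ (T% (fun y ↦ InnerProductSpace.gramSchmidt ℝ (fun j ↦ f j y) i :
      Π y : M, TangentSpace I y)) := by
  induction i using WellFoundedLT.induction with
  | ind i ih =>
  have heq : ∀ y, InnerProductSpace.gramSchmidt ℝ (fun j ↦ f j y) i =
      f i y - ∑ j ∈ Finset.Iio i,
        (inner ℝ (InnerProductSpace.gramSchmidt ℝ (fun j ↦ f j y) j) (f i y) /
          inner ℝ (InnerProductSpace.gramSchmidt ℝ (fun j ↦ f j y) j)
            (InnerProductSpace.gramSchmidt ℝ (fun j ↦ f j y) j) : ℝ) •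
          InnerProductSpace.gramSchmidt ℝ (fun j ↦ f j y) j := by
    intro y
    have := InnerProductSpace.gramSchmidt_def'' ℝ (fun j ↦ f j y) i
    simp only [RCLike.ofReal_real_eq_id, id_eq, ← real_inner_self_eq_norm_sq] at this
    exact eq_sub_of_add_eq this.symm
  simp_rw [heq]
  refine ContMDiffOn.sub_section (hf i) (ContMDiffOn.sum_section fun j hj ↦ ?_)
  have hg := ih j (Finset.mem_Iio.1 hj)
  refine ContMDiffOn.smul_section ?_ hg
  refine ContMDiffOn.div₀ (ContMDiffOn.inner_bundle hg (hf i)) (ContMDiffOn.inner_bundle hg hg) ?_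
  intro y hy h0
  exact InnerProductSpace.gramSchmidt_ne_zero j (hli y hy) (inner_self_eq_zero.1 h0)

theorem contMDiffOn_gramSchmidtNormed {n : ℕ} {f : Fin n → Π x : M, TangentSpace I x} {u : Set M}
    (hf : ∀ i, CMDiff[u] ∞ (T% (f i))) (hli : ∀ y ∈ u, LinearIndependent ℝ (fun i ↦ f i y))
    (i : Fin n) :
    CMDiff[u] ∞ (T% (fun y ↦ InnerProductSpace.gramSchmidtNormed ℝ (fun j ↦ f j y) i :
      Π y : M, TangentSpace I y)) := by
  have hg := contMDiffOn_gramSchmidt hf hli i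
  have h1 : ∀ y ∈ u, 0 < (inner ℝ (InnerProductSpace.gramSchmidt ℝ (fun j ↦ f j y) i)
      (InnerProductSpace.gramSchmidt ℝ (fun j ↦ f j y) i) : ℝ) := fun y hy ↦
    real_inner_self_pos.2 (InnerProductSpace.gramSchmidt_ne_zero i (hli y hy))
  have hs : CMDiff[u] ∞ (fun y ↦ (√(inner ℝ (InnerProductSpace.gramSchmidt ℝ (fun j ↦ f j y) i)
      (InnerProductSpace.gramSchmidt ℝ (fun j ↦ f j y) i)))⁻¹) := by
    refine ContMDiffOn.inv₀ ?_ fun y hy ↦ (Real.sqrt_pos.2 (h1 y hy)).ne'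
    have hin := ContMDiffOn.inner_bundle (E := fun x : M ↦ TangentSpace I x) hg hg
    intro y hy
    exact (Real.contDiffAt_sqrt (h1 y hy).ne').contMDiffAt.comp_contMDiffWithinAt y (hin y hy)
  refine (ContMDiffOn.smul_section hs hg).congr fun y hy ↦ ?_
  have hn := norm_eq_sqrt_real_inner (InnerProductSpace.gramSchmidt ℝ (fun j ↦ f j y) i)
  simp only [InnerProductSpace.gramSchmidtNormed, hn]
  rfl

variable [FiniteDimensional ℝ E]

/-- Near every point there is a smooth orthonormal frame, here consisting of global fields. -/
theorem exists_orthonormal_frame [T2Space M] (x : M) :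
    ∃ e : Fin (Module.finrank ℝ E) → Π y : M, TangentSpace I y, (∀ i, IsSmoothField (e i)) ∧
      ∀ᶠ y in 𝓝 x, Orthonormal ℝ (fun i ↦ e i y) := by
  let t := trivializationAt E (TangentSpace I : M → Type _) x
  have hx : t.baseSet ∈ 𝓝 x :=
    t.open_baseSet.mem_nhds (FiberBundle.mem_baseSet_trivializationAt E _ x)
  have hfr := t.isLocalFrameOn_localFrame_baseSet I ∞ (Module.finBasis ℝ E)
  have hg := fun i ↦ exists_isSmoothField_eventuallyEq hx
    (contMDiffOn_gramSchmidtNormed hfr.contMDiffOn (fun y hy ↦ hfr.linearIndependent hy) i)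
  choose e he hee using hg
  refine ⟨e, he, ?_⟩
  filter_upwards [hx, eventually_all.2 hee] with y hy hey
  have := InnerProductSpace.gramSchmidtNormed_orthonormal (hfr.linearIndependent hy)
  convert this using 2 with i
  exact (hey i).symm

end Frames

/-! ### Connections with torsion and the first Bianchi identity -/

section Connections

variable {E : Type*} [NormedAddCommGroup E] [NormedSpace ℝ E]
  {H : Type*} [TopologicalSpace H] {I : ModelWithCorners ℝ E H}
  {M : Type*} [TopologicalSpace M] [ChartedSpace H M] [IsManifold I ∞ M]
  {cov cov' : CovariantDerivative I E (TangentSpace I : M → Type _)}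

theorem cov_add_apply {X Y : Π x : M, TangentSpace I x} (hX : IsSmoothField X)
    (hY : IsSmoothField Y) (x : M) (v : TangentSpace I x) :
    cov (X + Y) x v = cov X x v + cov Y x v := by
  rw [cov.isCovariantDerivativeOnUniv.add (hX.mdifferentiableAt x) (hY.mdifferentiableAt x)]
  rfl

theorem cov_const_smul_apply {X : Π x : M, TangentSpace I x} (hX : IsSmoothField X) (c : ℝ)
    (x : M) (v : TangentSpace I x) : cov (c • X) x v = c • cov X x v := by
  rw [cov.isCovariantDerivativeOnUniv.smul_const c (hX.mdifferentiableAt x)]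
  rfl

theorem cov_sub_apply {X Y : Π x : M, TangentSpace I x} (hX : IsSmoothField X)
    (hY : IsSmoothField Y) (x : M) (v : TangentSpace I x) :
    cov (X - Y) x v = cov X x v - cov Y x v := by
  rw [show X - Y = X + (-1 : ℝ) • Y by ext1 y; simp [sub_eq_add_neg],
    cov_add_apply hX (hY.const_smul _), cov_const_smul_apply hY]
  simp [sub_eq_add_neg]

theorem isSmoothField_cov (hcov : cov.ContMDiffCovariantDerivative ∞)
    {X Y : Π x : M, TangentSpace I x} (hX : IsSmoothField X) (hY : IsSmoothField Y) :
    IsSmoothField (fun y ↦ cov Y y (X y)) := by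
  have h := contMDiffOn_univ.1 (hcov.contMDiff.contMDiff (σ := Y) (by
    rw [contMDiffOn_univ]; exact hY))
  exact ContMDiff.clm_bundle_apply h hX

/-- The curvature tensor, defined through fields which are only smooth near the base point, is
computed by the curvature on global smooth fields. -/
theorem curvature_congr_of_eventuallyEq
    (hcov : ∀ X Y : Π x : M, TangentSpace I x, IsSmoothField X → IsSmoothField Y →
      IsSmoothField (fun y ↦ cov Y y (X y)))
    {X Y Z X' Y' Z' : Π x : M, TangentSpace I x} (hX : IsSmoothField X)
    (hY : IsSmoothField Y) (hZ : IsSmoothField Z) {x : M} (hXX' : ∀ᶠ y in 𝓝 x, X' y = X y)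
    (hYY' : ∀ᶠ y in 𝓝 x, Y' y = Y y) (hZZ' : ∀ᶠ y in 𝓝 x, Z' y = Z y) :
    curvature cov X' Y' Z' x = curvature cov X Y Z x := by
  have hmd : ∀ {Z Z' : Π x : M, TangentSpace I x} {y : M}, IsSmoothField Z →
      (∀ᶠ z in 𝓝 y, Z' z = Z z) → MDiffAt (T% Z') y := fun {Z Z' y} hZ h ↦
    (hZ.mdifferentiableAt y).congr_of_eventuallyEq (h.mono fun z hz ↦ by simp [hz])
  have hcg : ∀ {Z Z' : Π x : M, TangentSpace I x} {y : M}, IsSmoothField Z →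
      (∀ᶠ z in 𝓝 y, Z' z = Z z) → cov Z' y = cov Z y := fun {Z Z' y} hZ h ↦
    cov.isCovariantDerivativeOnUniv.congr_of_eventuallyEq (hmd hZ h) (hZ.mdifferentiableAt y)
      Filter.univ_mem h
  have hin : ∀ {Y Y' : Π x : M, TangentSpace I x}, (∀ᶠ y in 𝓝 x, Y' y = Y y) →
      ∀ᶠ y in 𝓝 x, cov Z' y (Y' y) = cov Z y (Y y) := by
    intro Y Y' hYY'
    filter_upwards [hYY', eventually_eventually_nhds.2 hZZ'] with y hy hzy
    rw [hcg hZ hzy, hy]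
  have hbr : VectorField.mlieBracket I X' Y' x = VectorField.mlieBracket I X Y x :=
    Filter.EventuallyEq.mlieBracket_vectorField_eq hXX' hYY'
  rw [curvature, curvature, hcg (hcov Y Z hY hZ) (hin hYY'), hcg (hcov X Z hX hZ) (hin hXX'),
    hcg hZ hZZ', hbr, hXX'.self_of_nhds, hYY'.self_of_nhds]

variable [FiniteDimensional ℝ E]

theorem torsion_apply_of_isSmoothField {X Y : Π x : M, TangentSpace I x} (hX : IsSmoothField X)
    (hY : IsSmoothField Y) (x : M) :
    cov.torsion x (X x) (Y x) =
      cov Y x (X x) - cov X x (Y x) - VectorField.mlieBracket I X Y x :=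
  cov.torsion_apply (hX.mdifferentiableAt x) (hY.mdifferentiableAt x)

theorem isSmoothField_torsion (hcov : cov.ContMDiffCovariantDerivative ∞)
    {X Y : Π x : M, TangentSpace I x} (hX : IsSmoothField X) (hY : IsSmoothField Y) :
    IsSmoothField (fun y ↦ cov.torsion y (X y) (Y y)) := by
  rw [show (fun y ↦ cov.torsion y (X y) (Y y)) = ((fun y ↦ cov Y y (X y)) -
      (fun y ↦ cov X y (Y y)) - VectorField.mlieBracket I X Y : Π x : M, TangentSpace I x) from
    funext fun y ↦ torsion_apply_of_isSmoothField hX hY y]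
  exact ((isSmoothField_cov hcov hX hY).sub (isSmoothField_cov hcov hY hX)).sub
    (hX.mlieBracket hY)

theorem jacobi_mlieBracket {X Y Z : Π x : M, TangentSpace I x} (hX : IsSmoothField X)
    (hY : IsSmoothField Y) (hZ : IsSmoothField Z) (x : M) :
    VectorField.mlieBracket I (VectorField.mlieBracket I X Y) Z x +
      VectorField.mlieBracket I (VectorField.mlieBracket I Y Z) X x +
      VectorField.mlieBracket I (VectorField.mlieBracket I Z X) Y x = 0 := by
  have : IsManifold I (minSmoothness ℝ 3) M := by
    rw [minSmoothness_of_isRCLikeNormedField]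
    infer_instance
  have h2 : (minSmoothness ℝ 2 : ℕ∞ω) ≤ ∞ := by
    rw [minSmoothness_of_isRCLikeNormedField]
    exact ENat.LEInfty.out
  have h := VectorField.leibniz_identity_mlieBracket_apply (I := I) (x := x)
    ((hX x).of_le h2) ((hY x).of_le h2) ((hZ x).of_le h2)
  rw [VectorField.mlieBracket_swap_apply (V := VectorField.mlieBracket I Y Z),
    VectorField.mlieBracket_swap_apply (V := VectorField.mlieBracket I Z X), h,
    VectorField.mlieBracket_swap (V := Z) (W := X)]
  rw [show -VectorField.mlieBracket I X Z = (-1 : ℝ) • VectorField.mlieBracket I X Z by simp,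
    VectorField.mlieBracket_const_smul_right ((hX.mlieBracket hZ).mdifferentiableAt x)]
  module

/-- The vector valued covariant derivative `(∇'_V T)(X, Y)` of the torsion `T` of `∇`. -/
noncomputable def covDerivTorsion (cov cov' : CovariantDerivative I E (TangentSpace I : M → Type _))
    (V X Y : Π x : M, TangentSpace I x) (x : M) : TangentSpace I x :=
  cov' (fun y ↦ cov.torsion y (X y) (Y y)) x (V x) - cov.torsion x (cov' X x (V x)) (Y x)
    - cov.torsion x (X x) (cov' Y x (V x))

theorem covDerivTorsion_antisymm (hcov : cov.ContMDiffCovariantDerivative ∞)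
    {X Y : Π x : M, TangentSpace I x} (V : Π x : M, TangentSpace I x) (hX : IsSmoothField X)
    (hY : IsSmoothField Y) (x : M) :
    covDerivTorsion cov cov' V X Y x = -covDerivTorsion cov cov' V Y X x := by
  have h : (fun y ↦ cov.torsion y (X y) (Y y)) =
      ((-1 : ℝ) • (fun y ↦ cov.torsion y (Y y) (X y)) : Π x : M, TangentSpace I x) := by
    funext y
    simpa using cov.torsion_antisymm (X y) (Y y)
  rw [covDerivTorsion, covDerivTorsion, h,
    cov_const_smul_apply (isSmoothField_torsion hcov hY hX),
    cov.torsion_antisymm (cov' X x (V x)), cov.torsion_antisymm (X x)]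
  module

/-- The first Bianchi identity for a flat connection with torsion. -/
theorem IsFlat.bianchi (hcov : cov.ContMDiffCovariantDerivative ∞) (hflat : IsFlat cov)
    {X Y Z : Π x : M, TangentSpace I x} (hX : IsSmoothField X) (hY : IsSmoothField Y)
    (hZ : IsSmoothField Z) (x : M) :
    covDerivTorsion cov cov X Y Z x + covDerivTorsion cov cov Y Z X x
      + covDerivTorsion cov cov Z X Y x
      + cov.torsion x (cov.torsion x (X x) (Y x)) (Z x)
      + cov.torsion x (cov.torsion x (Y x) (Z x)) (X x)
      + cov.torsion x (cov.torsion x (Z x) (X x)) (Y x) = 0 := by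
  have key : ∀ {X Y Z : Π x : M, TangentSpace I x}, IsSmoothField X → IsSmoothField Y →
      IsSmoothField Z → cov (fun y ↦ cov.torsion y (Y y) (Z y)) x (X x) =
        cov (fun y ↦ cov Z y (Y y)) x (X x) - cov (fun y ↦ cov Y y (Z y)) x (X x)
          - cov (VectorField.mlieBracket I Y Z) x (X x) := by
    intro X Y Z hX hY hZ
    rw [show (fun y ↦ cov.torsion y (Y y) (Z y)) = ((fun y ↦ cov Z y (Y y)) -
      (fun y ↦ cov Y y (Z y)) - VectorField.mlieBracket I Y Z : Π x : M, TangentSpace I x) from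
      funext fun y ↦ torsion_apply_of_isSmoothField hY hZ y,
      cov_sub_apply ((isSmoothField_cov hcov hY hZ).sub (isSmoothField_cov hcov hZ hY))
        (hY.mlieBracket hZ),
      cov_sub_apply (isSmoothField_cov hcov hY hZ) (isSmoothField_cov hcov hZ hY)]
  have fl : ∀ {X Y Z : Π x : M, TangentSpace I x}, IsSmoothField X → IsSmoothField Y →
      IsSmoothField Z → cov (fun y ↦ cov Z y (Y y)) x (X x) - cov (fun y ↦ cov Z y (X y)) x (Y x)
        - cov Z x (VectorField.mlieBracket I X Y x) = 0 := fun hX hY hZ ↦ hflat _ _ _ hX hY hZ x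
  have br : ∀ {X Y Z : Π x : M, TangentSpace I x}, IsSmoothField X → IsSmoothField Y →
      IsSmoothField Z → cov.torsion x (VectorField.mlieBracket I X Y x) (Z x) =
        cov Z x (VectorField.mlieBracket I X Y x) - cov (VectorField.mlieBracket I X Y) x (Z x)
        - VectorField.mlieBracket I (VectorField.mlieBracket I X Y) Z x := fun hX hY hZ ↦
    torsion_apply_of_isSmoothField (hX.mlieBracket hY) hZ x
  have tt : ∀ {X Y Z : Π x : M, TangentSpace I x}, IsSmoothField X → IsSmoothField Y →
      IsSmoothField Z → cov.torsion x (cov.torsion x (X x) (Y x)) (Z x) =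
        cov.torsion x (cov Y x (X x)) (Z x) - cov.torsion x (cov X x (Y x)) (Z x)
        - cov.torsion x (VectorField.mlieBracket I X Y x) (Z x) := by
    intro X Y Z hX hY hZ
    rw [torsion_apply_of_isSmoothField hX hY]
    simp
  simp only [covDerivTorsion, key hX hY hZ, key hY hZ hX, key hZ hX hY,
    tt hX hY hZ, tt hY hZ hX, tt hZ hX hY, br hX hY hZ, br hY hZ hX, br hZ hX hY]
  rw [cov.torsion_antisymm (Y x) (cov Z x (X x)), cov.torsion_antisymm (Z x) (cov X x (Y x)),
    cov.torsion_antisymm (X x) (cov Y x (Z x))]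
  linear_combination (norm := module) fl hX hY hZ + fl hY hZ hX + fl hZ hX hY
    + jacobi_mlieBracket hX hY hZ x

/-- On smooth vector fields, `∇'_V X = ∇_V X + c T(V, X)`. -/
def IsTorsionShift (c : ℝ) (cov cov' : CovariantDerivative I E (TangentSpace I : M → Type _)) :
    Prop :=
  ∀ X : Π x : M, TangentSpace I x, IsSmoothField X → ∀ (x : M) (v : TangentSpace I x),
    cov' X x v = cov X x v + c • cov.torsion x v (X x)

theorem isTorsionShift_zero : IsTorsionShift 0 cov cov := fun X _ x v ↦ by simp

theorem IsTorsionShift.isSmoothField_cov {c : ℝ} (h : IsTorsionShift c cov cov')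
    (hcov : cov.ContMDiffCovariantDerivative ∞)
    {X Y : Π x : M, TangentSpace I x} (hX : IsSmoothField X) (hY : IsSmoothField Y) :
    IsSmoothField (fun y ↦ cov' Y y (X y)) := by
  rw [show (fun y ↦ cov' Y y (X y)) = ((fun y ↦ cov Y y (X y)) +
    c • (fun y ↦ cov.torsion y (X y) (Y y)) : Π x : M, TangentSpace I x) from
    funext fun y ↦ h Y hY y (X y)]
  exact (FlatTorsion.isSmoothField_cov hcov hX hY).add
    ((isSmoothField_torsion hcov hX hY).const_smul c)

end Connections

/-! ### The covariant derivative of a skew torsion -/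

section SkewTorsion

variable {E : Type*} [NormedAddCommGroup E] [NormedSpace ℝ E] [FiniteDimensional ℝ E]
  {H : Type*} [TopologicalSpace H] {I : ModelWithCorners ℝ E H}
  {M : Type*} [TopologicalSpace M] [ChartedSpace H M] [IsManifold I ∞ M]
  [RiemannianBundle (fun x : M ↦ TangentSpace I x)]
  {cov cov' : CovariantDerivative I E (TangentSpace I : M → Type _)}

theorem HasSkewTorsion.inner_swap (hskew : HasSkewTorsion cov) (x : M)
    (u v w : TangentSpace I x) :
    (inner ℝ (cov.torsion x u v) w : ℝ) = -inner ℝ (cov.torsion x u w) v := by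
  have h := hskew x ![u, v, w] (Equiv.swap 1 2)
  have h12 : (1 : Fin 3) ≠ 2 := by decide
  rw [Equiv.Perm.sign_swap h12] at h
  have h0 : (Equiv.swap (1 : Fin 3) 2) 0 = 0 := by decide
  have h1 : (Equiv.swap (1 : Fin 3) 2) 1 = 2 := by decide
  have h2 : (Equiv.swap (1 : Fin 3) 2) 2 = 1 := by decide
  simp only [torsionForm, Function.comp_apply, h0, h1, h2] at h
  simp at h
  linarith

theorem HasSkewTorsion.inner_rotate (hskew : HasSkewTorsion cov) (x : M)
    (u v w : TangentSpace I x) :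
    (inner ℝ (cov.torsion x u v) w : ℝ) = inner ℝ (cov.torsion x v w) u := by
  rw [cov.torsion_antisymm u v, inner_neg_left, hskew.inner_swap x v u w, neg_neg]

theorem inner_torsion_antisymm (x : M) (u v w : TangentSpace I x) :
    (inner ℝ (cov.torsion x u v) w : ℝ) = -inner ℝ (cov.torsion x v u) w := by
  rw [cov.torsion_antisymm u v, inner_neg_left]

/-- The `4`-tensor `a ⟨T(X,Y), T(Z,V)⟩ + b ⟨T(Y,Z), T(X,V)⟩ + c ⟨T(Z,X), T(Y,V)⟩`. Both `σ_T` and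
the Riemann curvature tensor are of this form. -/
noncomputable def torsionQuadratic
    (cov : CovariantDerivative I E (TangentSpace I : M → Type _)) (a b c : ℝ) :
    TensorField I M 4 :=
  fun x w ↦ a * inner ℝ (cov.torsion x (w 0) (w 1)) (cov.torsion x (w 2) (w 3))
    + b * inner ℝ (cov.torsion x (w 1) (w 2)) (cov.torsion x (w 0) (w 3))
    + c * inner ℝ (cov.torsion x (w 2) (w 0)) (cov.torsion x (w 1) (w 3))

theorem sigmaForm_eq_torsionQuadratic : sigmaForm cov = torsionQuadratic cov 1 1 1 := by
  funext x w
  simp [sigmaForm, torsionQuadratic]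

theorem covDeriv_torsionForm (V : Π x : M, TangentSpace I x)
    (X : Fin 3 → Π x : M, TangentSpace I x) (x : M) :
    covDeriv cov' (torsionForm cov) V X x =
      mvfderiv I (fun y ↦ (inner ℝ (cov.torsion y (X 0 y) (X 1 y)) (X 2 y) : ℝ)) x (V x)
      - inner ℝ (cov.torsion x (cov' (X 0) x (V x)) (X 1 x)) (X 2 x)
      - inner ℝ (cov.torsion x (X 0 x) (cov' (X 1) x (V x))) (X 2 x)
      - inner ℝ (cov.torsion x (X 0 x) (X 1 x)) (cov' (X 2) x (V x)) := by
  simp only [covDeriv, torsionForm, Fin.sum_univ_three]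
  simp only [Function.update_self, Function.update_of_ne, ne_eq, Fin.reduceEq, not_false_eq_true]
  ring

theorem covDeriv_torsionForm_eq_inner (hcov : cov.ContMDiffCovariantDerivative ∞)
    (hcov' : IsMetric cov') {V : Π x : M, TangentSpace I x} (hV : IsSmoothField V)
    {X : Fin 3 → Π x : M, TangentSpace I x} (hX : ∀ i, IsSmoothField (X i)) (x : M) :
    covDeriv cov' (torsionForm cov) V X x =
      inner ℝ (covDerivTorsion cov cov' V (X 0) (X 1) x) (X 2 x) := by
  rw [covDeriv_torsionForm, hcov' V _ _ hV (isSmoothField_torsion hcov (hX 0) (hX 1)) (hX 2) x,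
    covDerivTorsion, inner_sub_left, inner_sub_left]
  ring

theorem HasSkewTorsion.covDerivTorsion_swap (hskew : HasSkewTorsion cov)
    (hcov : cov.ContMDiffCovariantDerivative ∞) (hcov' : IsMetric cov')
    {V X Y Z : Π x : M, TangentSpace I x} (hV : IsSmoothField V) (hX : IsSmoothField X)
    (hY : IsSmoothField Y) (hZ : IsSmoothField Z) (x : M) :
    (inner ℝ (covDerivTorsion cov cov' V X Y x) (Z x) : ℝ) =
      -inner ℝ (covDerivTorsion cov cov' V X Z x) (Y x) := by
  have h1 := covDeriv_torsionForm_eq_inner hcov hcov' hV (X := ![X, Y, Z])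
    (by simp [Fin.forall_fin_succ, hX, hY, hZ]) x
  have h2 := covDeriv_torsionForm_eq_inner hcov hcov' hV (X := ![X, Z, Y])
    (by simp [Fin.forall_fin_succ, hX, hY, hZ]) x
  have hd : mvfderiv I (fun y ↦ (inner ℝ (cov.torsion y (X y) (Y y)) (Z y) : ℝ)) x =
      -mvfderiv I (fun y ↦ (inner ℝ (cov.torsion y (X y) (Z y)) (Y y) : ℝ)) x := by
    rw [← mvfderiv_fun_neg]
    congr 1
    funext y
    exact hskew.inner_swap y _ _ _
  simp only [covDeriv_torsionForm, Matrix.cons_val] at h1 h2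
  rw [hd, hskew.inner_swap x (cov' X x (V x)) (Y x), hskew.inner_swap x (X x) (cov' Y x (V x)),
    hskew.inner_swap x (X x) (Y x)] at h1
  rw [← h1, ← h2]
  simp only [neg_apply]
  ring

/-- The covariant derivative of the torsion of a flat metric connection with skew torsion:
`⟨(∇_V T)(X, Y), Z⟩ = σ_T(X, Y, Z, V) / 3`. The first Bianchi identity expresses the cyclic sum of
`∇T` over three of the four arguments through `σ_T`; since `∇T` is already skew in its last three
arguments, the four choices of the distinguished argument determine `∇T`. -/
theorem IsFlat.inner_covDerivTorsion (hcov : cov.ContMDiffCovariantDerivative ∞)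
    (hmetric : IsMetric cov) (hflat : IsFlat cov) (hskew : HasSkewTorsion cov)
    {V X Y Z : Π x : M, TangentSpace I x} (hV : IsSmoothField V) (hX : IsSmoothField X)
    (hY : IsSmoothField Y) (hZ : IsSmoothField Z) (x : M) :
    (inner ℝ (covDerivTorsion cov cov V X Y x) (Z x) : ℝ) =
      (1 / 3) * sigmaForm cov x ![X x, Y x, Z x, V x] := by
  have b : ∀ {X Y Z V : Π x : M, TangentSpace I x}, IsSmoothField X → IsSmoothField Y →
      IsSmoothField Z → IsSmoothField V →
      (inner ℝ (covDerivTorsion cov cov X Y Z x) (V x) : ℝ) +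
      inner ℝ (covDerivTorsion cov cov Y Z X x) (V x) +
      inner ℝ (covDerivTorsion cov cov Z X Y x) (V x) +
      inner ℝ (cov.torsion x (X x) (Y x)) (cov.torsion x (Z x) (V x)) +
      inner ℝ (cov.torsion x (Y x) (Z x)) (cov.torsion x (X x) (V x)) +
      inner ℝ (cov.torsion x (Z x) (X x)) (cov.torsion x (Y x) (V x)) = 0 := by
    intro X Y Z V hX hY hZ hV
    have h := congrArg (fun u ↦ (inner ℝ u (V x) : ℝ)) (hflat.bianchi hcov hX hY hZ x)
    simp only [inner_add_left, inner_zero_left] at h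
    rw [hskew.inner_rotate x (cov.torsion x (X x) (Y x)),
      hskew.inner_rotate x (cov.torsion x (Y x) (Z x)),
      hskew.inner_rotate x (cov.torsion x (Z x) (X x)),
      real_inner_comm (cov.torsion x (X x) (Y x)), real_inner_comm (cov.torsion x (Y x) (Z x)),
      real_inner_comm (cov.torsion x (Z x) (X x))] at h
    exact h
  have sw : ∀ {V X Y Z : Π x : M, TangentSpace I x}, IsSmoothField V → IsSmoothField X →
      IsSmoothField Y → IsSmoothField Z →
      (inner ℝ (covDerivTorsion cov cov V X Y x) (Z x) : ℝ) =
      -inner ℝ (covDerivTorsion cov cov V X Z x) (Y x) := fun hV hX hY hZ ↦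
    hskew.covDerivTorsion_swap hcov hmetric hV hX hY hZ x
  have an : ∀ {V X Y Z : Π x : M, TangentSpace I x}, IsSmoothField X →
      IsSmoothField Y →
      (inner ℝ (covDerivTorsion cov cov V X Y x) (Z x) : ℝ) =
      -inner ℝ (covDerivTorsion cov cov V Y X x) (Z x) := by
    intro V X Y Z hX hY
    rw [covDerivTorsion_antisymm hcov V hX hY, inner_neg_left]
  have tl : ∀ s t u v : TangentSpace I x, (inner ℝ (cov.torsion x s t) (cov.torsion x u v) : ℝ) =
      -inner ℝ (cov.torsion x t s) (cov.torsion x u v) := fun s t u v ↦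
    inner_torsion_antisymm x s t _
  have tr : ∀ s t u v : TangentSpace I x, (inner ℝ (cov.torsion x s t) (cov.torsion x u v) : ℝ) =
      -inner ℝ (cov.torsion x s t) (cov.torsion x v u) := fun s t u v ↦ by
    rw [cov.torsion_antisymm u v, inner_neg_right]
  have tc : ∀ s t u v : TangentSpace I x, (inner ℝ (cov.torsion x s t) (cov.torsion x u v) : ℝ) =
      inner ℝ (cov.torsion x u v) (cov.torsion x s t) := fun s t u v ↦ real_inner_comm _ _
  have e1 := b hX hY hZ hV
  have e2 := b hY hZ hV hX
  have e3 := b hZ hX hV hY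
  have e4 := b hX hY hV hZ
  simp only [sigmaForm, Matrix.cons_val]
  -- in the three identities involving `∇_V T`, all terms are brought to the order of `e1`
  have f2 := sw hY hZ hV hX
  have f3 := sw hZ hX hV hY
  have f4 := sw hX hY hV hZ
  have f5 : (inner ℝ (covDerivTorsion cov cov Z V Y x) (X x) : ℝ) =
      -inner ℝ (covDerivTorsion cov cov Z X Y x) (V x) := by
    rw [sw hZ hV hY hX, an hV hX, sw hZ hX hV hY, neg_neg]
  have f6 : (inner ℝ (covDerivTorsion cov cov X V Z x) (Y x) : ℝ) =
      -inner ℝ (covDerivTorsion cov cov X Y Z x) (V x) := by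
    rw [sw hX hV hZ hY, an hV hY, sw hX hY hV hZ, neg_neg]
  have f7 : (inner ℝ (covDerivTorsion cov cov Y V X x) (Z x) : ℝ) =
      -inner ℝ (covDerivTorsion cov cov Y Z X x) (V x) := by
    rw [sw hY hV hX hZ, an hV hZ, sw hY hZ hV hX, neg_neg]
  have f8 : (inner ℝ (covDerivTorsion cov cov V Y Z x) (X x) : ℝ) =
      inner ℝ (covDerivTorsion cov cov V X Y x) (Z x) := by
    rw [sw hV hY hZ hX, an hY hX, neg_neg]
  have f9 : (inner ℝ (covDerivTorsion cov cov V Z X x) (Y x) : ℝ) =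
      inner ℝ (covDerivTorsion cov cov V X Y x) (Z x) := by
    rw [an hZ hX, sw hV hX hZ hY, neg_neg]
  rw [f2, f5, f8] at e2
  rw [f3, f6, f9] at e3
  rw [f4, f7] at e4
  linarith [tr (Y x) (Z x) (V x) (X x), tc (Z x) (V x) (Y x) (X x), tl (Y x) (X x) (Z x) (V x),
    tc (V x) (Y x) (Z x) (X x), tr (Z x) (X x) (V x) (Y x), tc (X x) (V x) (Z x) (Y x),
    tl (Z x) (Y x) (X x) (V x), tc (V x) (Z x) (X x) (Y x), tr (X x) (Y x) (V x) (Z x),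
    tc (Y x) (V x) (X x) (Z x), tl (X x) (Z x) (Y x) (V x), tc (V x) (X x) (Y x) (Z x)]

end SkewTorsion

/-! ### Metric connections whose torsion is a multiple of `T` -/

section ScaledTorsion

variable {E : Type*} [NormedAddCommGroup E] [NormedSpace ℝ E] [FiniteDimensional ℝ E]
  {H : Type*} [TopologicalSpace H] {I : ModelWithCorners ℝ E H}
  {M : Type*} [TopologicalSpace M] [ChartedSpace H M] [IsManifold I ∞ M]
  [RiemannianBundle (fun x : M ↦ TangentSpace I x)]
  {cov cov' : CovariantDerivative I E (TangentSpace I : M → Type _)}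

theorem IsLeviCivita.isMetricWithScaledTorsion (h : IsLeviCivita cov') :
    IsMetricWithScaledTorsion 0 cov cov' :=
  ⟨h.1, fun x ↦ (h.2 x).trans (zero_smul ℝ (cov.torsion x)).symm⟩

/-- The Koszul argument: for skew `T`, the only metric connection with torsion `s T` is
`∇ + (s - 1) / 2 T`. -/
theorem IsMetricWithScaledTorsion.isTorsionShift [T2Space M] (hmetric : IsMetric cov)
    (hskew : HasSkewTorsion cov) {s : ℝ} (h : IsMetricWithScaledTorsion s cov cov') :
    IsTorsionShift ((s - 1) / 2) cov cov' := by
  intro Y hY x v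
  obtain ⟨X, hX, rfl⟩ := exists_isSmoothField_apply_eq v
  refine ext_inner_right ℝ fun w ↦ ?_
  obtain ⟨Z, hZ, rfl⟩ := exists_isSmoothField_apply_eq w
  have met : ∀ {X Y Z : Π x : M, TangentSpace I x}, IsSmoothField X → IsSmoothField Y →
      IsSmoothField Z → (inner ℝ (cov' Y x (X x)) (Z x) : ℝ) - inner ℝ (cov Y x (X x)) (Z x) =
        -(inner ℝ (cov' Z x (X x)) (Y x) - inner ℝ (cov Z x (X x)) (Y x)) := by
    intro X Y Z hX hY hZ
    have h1 := h.1 X Y Z hX hY hZ x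
    have h2 := hmetric X Y Z hX hY hZ x
    rw [real_inner_comm (cov' Z x (X x))] at h1
    rw [real_inner_comm (cov Z x (X x))] at h2
    linarith
  have tor : ∀ {X Y Z : Π x : M, TangentSpace I x}, IsSmoothField X → IsSmoothField Y →
      (inner ℝ (cov' Y x (X x)) (Z x) : ℝ) - inner ℝ (cov Y x (X x)) (Z x) =
        inner ℝ (cov' X x (Y x)) (Z x) - inner ℝ (cov X x (Y x)) (Z x)
          + (s - 1) * inner ℝ (cov.torsion x (X x) (Y x)) (Z x) := by
    intro X Y Z hX hY
    have h1 := torsion_apply_of_isSmoothField (cov := cov') hX hY x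
    have h2 := torsion_apply_of_isSmoothField (cov := cov) hX hY x
    rw [h.2 x] at h1
    have h3 := congrArg (fun u ↦ (inner ℝ u (Z x) : ℝ)) h1
    have h4 := congrArg (fun u ↦ (inner ℝ u (Z x) : ℝ)) h2
    simp only [smul_apply, inner_sub_left, real_inner_smul_left] at h3 h4
    linarith
  rw [inner_add_left, real_inner_smul_left]
  linear_combination (1 / 2) * (tor hX hY (Z := Z) + met hY hX hZ - tor hY hZ (Z := X)
    - met hZ hY hX + tor hZ hX (Z := Y) + met hX hZ hY)
    - (s - 1) / 2 * hskew.inner_rotate x (Y x) (Z x) (X x)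

theorem exists_isMetricWithScaledTorsion [T2Space M] (hcov : cov.ContMDiffCovariantDerivative ∞)
    (hmetric : IsMetric cov) (hskew : HasSkewTorsion cov) (s : ℝ) :
    ∃ cov' : CovariantDerivative I E (TangentSpace I : M → Type _),
      cov'.ContMDiffCovariantDerivative ∞ ∧ IsMetricWithScaledTorsion s cov cov' := by
  let c := (s - 1) / 2
  let cov' := cov.addOneForm (fun x ↦ c • (cov.torsion x).flip)
  have happ : ∀ (X : Π x : M, TangentSpace I x) (x : M) (v : TangentSpace I x),
      cov' X x v = cov X x v + c • cov.torsion x v (X x) := fun X x v ↦ rfl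
  refine ⟨cov', ⟨⟨fun {σ} hσ ↦ ?_⟩⟩, fun V X Y hV hX hY x ↦ ?_, fun x ↦ ?_⟩
  · have hσ' : IsSmoothField σ := by
      rw [contMDiffOn_univ] at hσ
      exact hσ
    refine ContMDiffOn.add_section (hcov.contMDiff.contMDiff hσ) ?_
    rw [contMDiffOn_univ]
    refine contMDiff_hom_of_isSmoothField (fun x ↦ (c • (cov.torsion x).flip) (σ x)) fun X hX ↦ ?_
    exact (isSmoothField_torsion hcov hX hσ').const_smul c
  · rw [hmetric V X Y hV hX hY x, happ, happ, inner_add_left, inner_add_right,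
      real_inner_smul_left, real_inner_smul_right, real_inner_comm (cov.torsion x (V x) (Y x)),
      hskew.inner_swap x (V x) (Y x)]
    ring
  · ext u v
    obtain ⟨X, hX, rfl⟩ := exists_isSmoothField_apply_eq u
    obtain ⟨Y, hY, rfl⟩ := exists_isSmoothField_apply_eq v
    have h2 := torsion_apply_of_isSmoothField (cov := cov) hX hY x
    rw [torsion_apply_of_isSmoothField hX hY, happ, happ, cov.torsion_antisymm (Y x) (X x)]
    simp only [smul_apply]
    rw [show cov Y x (X x) = cov.torsion x (X x) (Y x) + cov X x (Y x)
      + VectorField.mlieBracket I X Y x by rw [h2]; abel]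
    simp only [c]
    module

theorem IsTorsionShift.covDeriv_torsionForm (hcov : cov.ContMDiffCovariantDerivative ∞)
    (hmetric : IsMetric cov) (hflat : IsFlat cov) (hskew : HasSkewTorsion cov) {c : ℝ}
    (h : IsTorsionShift c cov cov') {V : Π x : M, TangentSpace I x} (hV : IsSmoothField V)
    {X : Fin 3 → Π x : M, TangentSpace I x} (hX : ∀ i, IsSmoothField (X i)) (x : M) :
    covDeriv cov' (torsionForm cov) V X x =
      (1 / 3 + c) * sigmaForm cov x ![X 0 x, X 1 x, X 2 x, V x] := by
  have h1 := covDeriv_torsionForm_eq_inner hcov hmetric hV hX x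
  rw [hflat.inner_covDerivTorsion hcov hmetric hskew hV (hX 0) (hX 1) (hX 2),
    FlatTorsion.covDeriv_torsionForm] at h1
  rw [FlatTorsion.covDeriv_torsionForm, h _ (hX 0), h _ (hX 1), h _ (hX 2)]
  simp only [map_add, map_smul, add_apply, smul_apply,
    inner_add_left, inner_add_right, real_inner_smul_left, real_inner_smul_right]
  have e1 : (inner ℝ (cov.torsion x (cov.torsion x (V x) (X 0 x)) (X 1 x)) (X 2 x) : ℝ) =
      -inner ℝ (cov.torsion x (X 1 x) (X 2 x)) (cov.torsion x (X 0 x) (V x)) := by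
    rw [hskew.inner_rotate, cov.torsion_antisymm (V x), inner_neg_right]
  have e2 : (inner ℝ (cov.torsion x (X 0 x) (cov.torsion x (V x) (X 1 x))) (X 2 x) : ℝ) =
      -inner ℝ (cov.torsion x (X 2 x) (X 0 x)) (cov.torsion x (X 1 x) (V x)) := by
    rw [← hskew.inner_rotate, cov.torsion_antisymm (V x), inner_neg_right]
  have e3 : (inner ℝ (cov.torsion x (X 0 x) (X 1 x)) (cov.torsion x (V x) (X 2 x)) : ℝ) =
      -inner ℝ (cov.torsion x (X 0 x) (X 1 x)) (cov.torsion x (X 2 x) (V x)) := by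
    rw [cov.torsion_antisymm (V x), inner_neg_right]
  rw [e1, e2, e3]
  simp only [sigmaForm, Matrix.cons_val] at h1 ⊢
  linarith

theorem inner_covDerivTorsion_eq_covDeriv (hcov : cov.ContMDiffCovariantDerivative ∞)
    (hcov' : IsMetric cov') {V X Y Z : Π x : M, TangentSpace I x} (hV : IsSmoothField V)
    (hX : IsSmoothField X) (hY : IsSmoothField Y) (hZ : IsSmoothField Z) (x : M) :
    (inner ℝ (covDerivTorsion cov cov' V X Y x) (Z x) : ℝ) =
      covDeriv cov' (torsionForm cov) V ![X, Y, Z] x :=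
  (covDeriv_torsionForm_eq_inner hcov hcov' hV (X := ![X, Y, Z])
    (by simp [Fin.forall_fin_succ, hX, hY, hZ]) x).symm

/-- The torsion is parallel for the connection `∇^{1/3} = ∇ - T / 3`. -/
theorem IsTorsionShift.covDerivTorsion_eq_zero [T2Space M]
    (hcov : cov.ContMDiffCovariantDerivative ∞)
    (hmetric : IsMetric cov) (hflat : IsFlat cov) (hskew : HasSkewTorsion cov)
    (hcov' : IsMetric cov')
    (h : IsTorsionShift (-(1 / 3)) cov cov') {V X Y : Π x : M, TangentSpace I x}
    (hV : IsSmoothField V) (hX : IsSmoothField X) (hY : IsSmoothField Y) (x : M) :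
    covDerivTorsion cov cov' V X Y x = 0 := by
  refine ext_inner_right ℝ fun w ↦ ?_
  obtain ⟨Z, hZ, rfl⟩ := exists_isSmoothField_apply_eq w
  rw [inner_covDerivTorsion_eq_covDeriv hcov hcov' hV hX hY hZ,
    h.covDeriv_torsionForm hcov hmetric hflat hskew hV
      (by simp [Fin.forall_fin_succ, hX, hY, hZ]),
    add_neg_cancel, zero_mul, inner_zero_left]

theorem isParallel_torsionQuadratic [T2Space M]
    [IsContMDiffRiemannianBundle I ∞ E (fun x : M ↦ TangentSpace I x)]
    (hcov : cov.ContMDiffCovariantDerivative ∞)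
    (hcov' : IsMetric cov')
    (h : ∀ V X Y : Π x : M, TangentSpace I x, IsSmoothField V → IsSmoothField X →
      IsSmoothField Y → ∀ x, covDerivTorsion cov cov' V X Y x = 0) (a b c : ℝ) :
    IsParallel cov' (torsionQuadratic cov a b c) := by
  intro V X hV hX x
  have hT := fun i j ↦ isSmoothField_torsion hcov (hX i) (hX j)
  have hd : ∀ i j k l, mvfderiv I (fun y ↦ (inner ℝ (cov.torsion y (X i y) (X j y))
      (cov.torsion y (X k y) (X l y)) : ℝ)) x (V x) =
      inner ℝ (cov.torsion x (cov' (X i) x (V x)) (X j x)) (cov.torsion x (X k x) (X l x))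
      + inner ℝ (cov.torsion x (X i x) (cov' (X j) x (V x))) (cov.torsion x (X k x) (X l x))
      + inner ℝ (cov.torsion x (X i x) (X j x)) (cov.torsion x (cov' (X k) x (V x)) (X l x))
      + inner ℝ (cov.torsion x (X i x) (X j x)) (cov.torsion x (X k x) (cov' (X l) x (V x))) := by
    intro i j k l
    have hv : ∀ i j, cov' (fun y ↦ cov.torsion y (X i y) (X j y)) x (V x) =
        cov.torsion x (cov' (X i) x (V x)) (X j x) + cov.torsion x (X i x) (cov' (X j) x (V x)) := by
      intro i j
      have := h V (X i) (X j) hV (hX i) (hX j) x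
      rw [covDerivTorsion, sub_sub, sub_eq_zero] at this
      exact this
    rw [hcov' V _ _ hV (hT i j) (hT k l) x, hv, hv, inner_add_left, inner_add_right]
    ring
  have hm := fun i j k l ↦ (hT i j).mdifferentiableAt_inner (hT k l) x
  have hmul : ∀ (r : ℝ) (i j k l), MDiffAt (fun y ↦ r * (inner ℝ (cov.torsion y (X i y) (X j y))
      (cov.torsion y (X k y) (X l y)) : ℝ)) x := fun r i j k l ↦
    mdifferentiableAt_const.mul (hm i j k l)
  have hc : ∀ (r : ℝ) (i j k l), mvfderiv I (fun y ↦ r * (inner ℝ (cov.torsion y (X i y) (X j y))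
      (cov.torsion y (X k y) (X l y)) : ℝ)) x = r • mvfderiv I (fun y ↦
        (inner ℝ (cov.torsion y (X i y) (X j y)) (cov.torsion y (X k y) (X l y)) : ℝ)) x := by
    intro r i j k l
    rw [mvfderiv_fun_mul mdifferentiableAt_const (hm i j k l), mvfderiv_const]
    simp
  simp only [covDeriv, torsionQuadratic]
  have hadd : MDiffAt (fun y ↦ a * (inner ℝ (cov.torsion y (X 0 y) (X 1 y))
      (cov.torsion y (X 2 y) (X 3 y)) : ℝ) + b * (inner ℝ (cov.torsion y (X 1 y) (X 2 y))
      (cov.torsion y (X 0 y) (X 3 y)) : ℝ)) x := (hmul a 0 1 2 3).add (hmul b 1 2 0 3)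
  rw [mvfderiv_fun_add hadd (hmul c 2 0 1 3),
    mvfderiv_fun_add (hmul a 0 1 2 3) (hmul b 1 2 0 3), hc, hc, hc]
  simp only [add_apply, smul_apply, hd, smul_eq_mul,
    Fin.sum_univ_four]
  simp only [Function.update_self, Function.update_of_ne, ne_eq, Fin.reduceEq, not_false_eq_true]
  ring

/-- The curvature of `∇ + c T` for a flat metric connection `∇` with skew torsion. -/
theorem IsTorsionShift.inner_curvature (hcov : cov.ContMDiffCovariantDerivative ∞)
    (hmetric : IsMetric cov) (hflat : IsFlat cov) (hskew : HasSkewTorsion cov) {c : ℝ}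
    (h : IsTorsionShift c cov cov') {X Y Z V : Π x : M, TangentSpace I x} (hX : IsSmoothField X)
    (hY : IsSmoothField Y) (hZ : IsSmoothField Z) (hV : IsSmoothField V) (x : M) :
    (inner ℝ (curvature cov' X Y Z x) (V x) : ℝ) =
      torsionQuadratic cov (c / 3) (-(2 * c / 3) - c ^ 2) (-(2 * c / 3) - c ^ 2) x
        ![X x, Y x, Z x, V x] := by
  have key : ∀ {X Y : Π x : M, TangentSpace I x}, IsSmoothField X → IsSmoothField Y →
      cov' (fun y ↦ cov' Z y (Y y)) x (X x) = cov (fun y ↦ cov Z y (Y y)) x (X x)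
        + c • cov (fun y ↦ cov.torsion y (Y y) (Z y)) x (X x)
        + c • cov.torsion x (X x) (cov Z x (Y x))
        + c ^ 2 • cov.torsion x (X x) (cov.torsion x (Y x) (Z x)) := by
    intro X Y hX hY
    have hDZ := FlatTorsion.isSmoothField_cov hcov hY hZ
    have hTZ := isSmoothField_torsion hcov hY hZ
    rw [h _ (h.isSmoothField_cov hcov hY hZ), show (fun y ↦ cov' Z y (Y y)) =
      ((fun y ↦ cov Z y (Y y)) + c • (fun y ↦ cov.torsion y (Y y) (Z y)) :
        Π x : M, TangentSpace I x) from funext fun y ↦ h Z hZ y (Y y),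
      cov_add_apply hDZ (hTZ.const_smul c), cov_const_smul_apply hTZ, h Z hZ x (Y x),
      map_add, map_smul]
    module
  have hbr : cov.torsion x (VectorField.mlieBracket I X Y x) (Z x) =
      cov.torsion x (cov Y x (X x)) (Z x) - cov.torsion x (cov X x (Y x)) (Z x)
        - cov.torsion x (cov.torsion x (X x) (Y x)) (Z x) := by
    rw [torsion_apply_of_isSmoothField hX hY]
    simp
  -- the curvature of `∇` drops out, and the terms linear in `c` assemble into `∇T`
  have hcurv : curvature cov' X Y Z x = c • (covDerivTorsion cov cov X Y Z x
      - covDerivTorsion cov cov Y X Z x + cov.torsion x (cov.torsion x (X x) (Y x)) (Z x))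
      + c ^ 2 • (cov.torsion x (X x) (cov.torsion x (Y x) (Z x))
        - cov.torsion x (Y x) (cov.torsion x (X x) (Z x))) := by
    have hf := hflat X Y Z hX hY hZ x
    rw [curvature, sub_sub, sub_eq_zero] at hf
    rw [curvature, key hX hY, key hY hX, h Z hZ, hbr, covDerivTorsion, covDerivTorsion]
    linear_combination (norm := module) hf
  rw [hcurv, inner_add_left, real_inner_smul_left, real_inner_smul_left, inner_add_left,
    inner_sub_left, inner_sub_left,
    hflat.inner_covDerivTorsion hcov hmetric hskew hX hY hZ hV,
    hflat.inner_covDerivTorsion hcov hmetric hskew hY hX hZ hV]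
  have e1 : (inner ℝ (cov.torsion x (cov.torsion x (X x) (Y x)) (Z x)) (V x) : ℝ) =
      inner ℝ (cov.torsion x (X x) (Y x)) (cov.torsion x (Z x) (V x)) := by
    rw [hskew.inner_rotate, real_inner_comm]
  have e2 : (inner ℝ (cov.torsion x (X x) (cov.torsion x (Y x) (Z x))) (V x) : ℝ) =
      -inner ℝ (cov.torsion x (Y x) (Z x)) (cov.torsion x (X x) (V x)) := by
    rw [hskew.inner_swap, real_inner_comm]
  have e3 : (inner ℝ (cov.torsion x (Y x) (cov.torsion x (X x) (Z x))) (V x) : ℝ) =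
      inner ℝ (cov.torsion x (Z x) (X x)) (cov.torsion x (Y x) (V x)) := by
    rw [hskew.inner_swap, real_inner_comm, cov.torsion_antisymm (X x) (Z x), inner_neg_left,
      neg_neg]
  rw [e1, e2, e3]
  simp only [sigmaForm, torsionQuadratic, Matrix.cons_val]
  rw [cov.torsion_antisymm (V x) (X x), cov.torsion_antisymm (V x) (Y x),
    cov.torsion_antisymm (Y x) (X x), cov.torsion_antisymm (X x) (Z x),
    cov.torsion_antisymm (Z x) (Y x)]
  simp only [inner_neg_left, inner_neg_right]
  rw [real_inner_comm (cov.torsion x (X x) (Y x)) (cov.torsion x (Z x) (V x)),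
    real_inner_comm (cov.torsion x (Y x) (Z x)) (cov.torsion x (X x) (V x)),
    real_inner_comm (cov.torsion x (Z x) (X x)) (cov.torsion x (Y x) (V x))]
  ring

theorem IsTorsionShift.curvatureTensor_eq [T2Space M] (hcov : cov.ContMDiffCovariantDerivative ∞)
    (hmetric : IsMetric cov) (hflat : IsFlat cov) (hskew : HasSkewTorsion cov) {c : ℝ}
    (h : IsTorsionShift c cov cov') :
    curvatureTensor cov' =
      torsionQuadratic cov (c / 3) (-(2 * c / 3) - c ^ 2) (-(2 * c / 3) - c ^ 2) := by
  funext x w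
  choose X hX hXw using fun i ↦ exists_isSmoothField_eventuallyEq_extend (w i)
  have hx : ∀ i, X i x = w i := fun i ↦ by simpa using (hXw i).self_of_nhds.symm
  rw [curvatureTensor, curvature_congr_of_eventuallyEq
    (fun X Y hX hY ↦ h.isSmoothField_cov hcov hX hY) (hX 0) (hX 1) (hX 2) (hXw 0) (hXw 1) (hXw 2),
    ← hx 3, h.inner_curvature hcov hmetric hflat hskew (hX 0) (hX 1) (hX 2) (hX 3)]
  simp only [hx]
  rfl

end ScaledTorsion

/-! ### The norm and the exterior derivative of the torsion -/

section OrthonormalBases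

variable {V ι κ : Type*} [NormedAddCommGroup V] [InnerProductSpace ℝ V] [Fintype ι] [Fintype κ]

theorem _root_.OrthonormalBasis.sum_inner_sq (b : OrthonormalBasis ι ℝ V) (v : V) :
    ∑ i, (inner ℝ v (b i) : ℝ) ^ 2 = ‖v‖ ^ 2 := by
  simpa only [Real.norm_eq_abs, sq_abs, real_inner_comm] using b.sum_sq_norm_inner_right v

/-- For a bilinear map `τ` such that `⟨τ(u, v), w⟩` is invariant under cyclic permutations, the sum
of the squared norms `‖τ(bᵢ, bⱼ)‖²` is the same for all orthonormal bases. -/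
theorem sum_norm_sq_eq_of_orthonormalBasis {τ : V → V → V}
    (hτ : ∀ u v w, (inner ℝ (τ u v) w : ℝ) = inner ℝ (τ v w) u) (b : OrthonormalBasis ι ℝ V)
    (b' : OrthonormalBasis κ ℝ V) :
    ∑ i, ∑ j, ‖τ (b i) (b j)‖ ^ 2 = ∑ i, ∑ j, ‖τ (b' i) (b' j)‖ ^ 2 := by
  calc ∑ i, ∑ j, ‖τ (b i) (b j)‖ ^ 2
      = ∑ i, ∑ j, ∑ k, (inner ℝ (τ (b i) (b j)) (b' k) : ℝ) ^ 2 := by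
        simp only [b'.sum_inner_sq]
    _ = ∑ j, ∑ k, ∑ i, (inner ℝ (τ (b j) (b' k)) (b i) : ℝ) ^ 2 := by
        rw [Finset.sum_comm]
        refine Finset.sum_congr rfl fun j _ ↦ ?_
        rw [Finset.sum_comm]
        refine Finset.sum_congr rfl fun k _ ↦ Finset.sum_congr rfl fun i _ ↦ ?_
        rw [hτ]
    _ = ∑ j, ∑ k, ∑ l, (inner ℝ (τ (b j) (b' k)) (b' l) : ℝ) ^ 2 := by
        simp only [OrthonormalBasis.sum_inner_sq]
    _ = ∑ k, ∑ l, ∑ j, (inner ℝ (τ (b' k) (b' l)) (b j) : ℝ) ^ 2 := by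
        rw [Finset.sum_comm]
        refine Finset.sum_congr rfl fun k _ ↦ ?_
        rw [Finset.sum_comm]
        refine Finset.sum_congr rfl fun l _ ↦ Finset.sum_congr rfl fun j _ ↦ ?_
        rw [hτ]
    _ = ∑ i, ∑ j, ‖τ (b' i) (b' j)‖ ^ 2 := by
        simp only [b.sum_inner_sq]

/-- An infinitesimal rotation `bᵢ ↦ aᵢ` of an orthonormal basis does not change
`∑ i, ⟨τ(bᵢ), τ(bᵢ)⟩` to first order. -/
theorem sum_inner_eq_zero_of_skew {W : Type*} [NormedAddCommGroup W] [InnerProductSpace ℝ W]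
    (τ : V →ₗ[ℝ] W) (b : OrthonormalBasis ι ℝ V) {a : ι → V}
    (ha : ∀ i l, (inner ℝ (a i) (b l) : ℝ) = -inner ℝ (a l) (b i)) :
    ∑ i, (inner ℝ (τ (a i)) (τ (b i)) : ℝ) = 0 := by
  have h : ∑ i, (inner ℝ (τ (a i)) (τ (b i)) : ℝ) =
      ∑ i, ∑ l, inner ℝ (a i) (b l) * inner ℝ (τ (b l)) (τ (b i)) := by
    refine Finset.sum_congr rfl fun i _ ↦ ?_
    conv_lhs => rw [← b.sum_repr' (a i), map_sum, sum_inner]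
    refine Finset.sum_congr rfl fun l _ ↦ ?_
    rw [map_smul, real_inner_smul_left, real_inner_comm]
  have h' : ∑ i, (inner ℝ (τ (a i)) (τ (b i)) : ℝ) =
      -∑ i, ∑ l, inner ℝ (a i) (b l) * inner ℝ (τ (b l)) (τ (b i)) := by
    rw [h]
    conv_lhs => rw [Finset.sum_comm]
    rw [← Finset.sum_neg_distrib]
    refine Finset.sum_congr rfl fun i _ ↦ ?_
    rw [← Finset.sum_neg_distrib]
    refine Finset.sum_congr rfl fun l _ ↦ ?_
    rw [ha l i, real_inner_comm (τ (b l)) (τ (b i))]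
    ring
  linarith

end OrthonormalBases

section Invariants

variable {E : Type*} [NormedAddCommGroup E] [NormedSpace ℝ E] [FiniteDimensional ℝ E]
  {H : Type*} [TopologicalSpace H] {I : ModelWithCorners ℝ E H}
  {M : Type*} [TopologicalSpace M] [ChartedSpace H M] [IsManifold I ∞ M]
  [RiemannianBundle (fun x : M ↦ TangentSpace I x)]
  {cov cov' : CovariantDerivative I E (TangentSpace I : M → Type _)}

/-- The sum of `‖T(eᵢ, eⱼ)‖²` over an orthonormal basis, which is `6 ‖T‖²`. -/
noncomputable def torsionNormSq (cov : CovariantDerivative I E (TangentSpace I : M → Type _))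
    (x : M) : ℝ :=
  ∑ i, ∑ j, ‖cov.torsion x (orthoBasis I x i) (orthoBasis I x j)‖ ^ 2

theorem threeFormNorm_torsionForm (x : M) :
    threeFormNorm (torsionForm cov) x = √((1 / 6) * torsionNormSq cov x) := by
  simp only [threeFormNorm, torsionForm, torsionNormSq, Matrix.cons_val,
    OrthonormalBasis.sum_inner_sq]

/-- If the skew torsion `T` of `∇` is parallel for a metric connection `∇'`, then `‖T‖²` has zero
derivative: in a smooth orthonormal frame, the derivative of the frame is an infinitesimal
rotation, which does not contribute. -/
theorem hasMFDerivAt_torsionNormSq [T2Space M]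
    [IsContMDiffRiemannianBundle I ∞ E (fun x : M ↦ TangentSpace I x)]
    (hcov : cov.ContMDiffCovariantDerivative ∞) (hskew : HasSkewTorsion cov)
    (hcov' : IsMetric cov')
    (h : ∀ V X Y : Π x : M, TangentSpace I x, IsSmoothField V → IsSmoothField X →
      IsSmoothField Y → ∀ x, covDerivTorsion cov cov' V X Y x = 0) (x : M) :
    HasMFDerivAt I 𝓘(ℝ, ℝ) (torsionNormSq cov) x (0 : TangentSpace I x →L[ℝ] ℝ) := by
  obtain ⟨e, he, heo⟩ := exists_orthonormal_frame (I := I) x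
  have hbasis : ∀ y : M, Orthonormal ℝ (fun i ↦ e i y) →
      ∃ b : OrthonormalBasis (Fin (Module.finrank ℝ E)) ℝ (TangentSpace I y), ∀ i, b i = e i y := by
    intro y hy
    have hspan := hy.linearIndependent.span_eq_top_of_card_eq_finrank' (Fintype.card_fin _)
    exact ⟨OrthonormalBasis.mk hy hspan.ge, fun i ↦ by simp⟩
  let T : Fin (Module.finrank ℝ E) × Fin (Module.finrank ℝ E) → Π y : M, TangentSpace I y :=
    fun p y ↦ cov.torsion y (e p.1 y) (e p.2 y)
  have hT : ∀ p, IsSmoothField (T p) := fun p ↦ isSmoothField_torsion hcov (he p.1) (he p.2)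
  let f : M → ℝ := fun y ↦ ∑ p, (inner ℝ (T p y) (T p y) : ℝ)
  have hfe : torsionNormSq cov =ᶠ[𝓝 x] f := by
    filter_upwards [heo] with y hy
    obtain ⟨b, hb⟩ := hbasis y hy
    rw [torsionNormSq, sum_norm_sq_eq_of_orthonormalBasis
      (τ := fun u v ↦ cov.torsion y u v) (hskew.inner_rotate y) (orthoBasis I y) b]
    simp only [f, T, hb, Fintype.sum_prod_type, real_inner_self_eq_norm_sq]
  obtain ⟨hfd, hfs⟩ := mvfderiv_sum (I := I) (x := x) Finset.univ
    (f := fun p y ↦ (inner ℝ (T p y) (T p y) : ℝ))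
    (fun p _ ↦ (hT p).mdifferentiableAt_inner (hT p) x)
  obtain ⟨b, hb⟩ := hbasis x heo.self_of_nhds
  have hf0 : mvfderiv I f x = 0 := by
    ext v
    obtain ⟨V, hV, rfl⟩ := exists_isSmoothField_apply_eq v
    have hrot : ∀ i l, (inner ℝ (cov' (e i) x (V x)) (b l) : ℝ) =
        -inner ℝ (cov' (e l) x (V x)) (b i) := by
      intro i l
      have hconst : (fun y ↦ (inner ℝ (e i y) (e l y) : ℝ)) =ᶠ[𝓝 x]
          fun _ ↦ if i = l then 1 else 0 := by
        filter_upwards [heo] with y hy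
        exact orthonormal_iff_ite.1 hy i l
      have h0 : mvfderiv I (fun y ↦ (inner ℝ (e i y) (e l y) : ℝ)) x (V x) = 0 := by
        have := ((hasMFDerivAt_const (I := I) (I' := 𝓘(ℝ, ℝ)) (if i = l then (1 : ℝ) else 0) x
          ).congr_of_eventuallyEq hconst).mfderiv
        exact congrArg (fun L : TangentSpace I x →L[ℝ] ℝ ↦ L (V x)) this
      rw [hcov' V _ _ hV (he i) (he l) x, real_inner_comm (cov' (e l) x (V x))] at h0
      rw [hb, hb]
      linarith
    have hTd : ∀ i j, cov' (T (i, j)) x (V x) =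
        cov.torsion x (cov' (e i) x (V x)) (b j) + cov.torsion x (b i) (cov' (e j) x (V x)) := by
      intro i j
      have := h V (e i) (e j) hV (he i) (he j) x
      rw [covDerivTorsion, sub_sub, sub_eq_zero] at this
      rw [hb, hb]
      exact this
    have hd : ∀ i j, mvfderiv I (fun y ↦ (inner ℝ (T (i, j) y) (T (i, j) y) : ℝ)) x (V x) =
        2 * inner ℝ (cov.torsion x (cov' (e i) x (V x)) (b j)) (cov.torsion x (b i) (b j))
        + 2 * inner ℝ (cov.torsion x (b i) (cov' (e j) x (V x))) (cov.torsion x (b i) (b j)) := by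
      intro i j
      rw [hcov' V _ _ hV (hT _) (hT _) x, real_inner_comm (cov' (T (i, j)) x (V x)), hTd,
        inner_add_left]
      simp only [T, hb]
      ring
    have hs1 : ∀ j, ∑ i, (inner ℝ (cov.torsion x (cov' (e i) x (V x)) (b j))
        (cov.torsion x (b i) (b j)) : ℝ) = 0 := fun j ↦
      sum_inner_eq_zero_of_skew ((cov.torsion x).flip (b j)).toLinearMap b hrot
    have hs2 : ∀ i, ∑ j, (inner ℝ (cov.torsion x (b i) (cov' (e j) x (V x)))
        (cov.torsion x (b i) (b j)) : ℝ) = 0 := fun i ↦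
      sum_inner_eq_zero_of_skew (cov.torsion x (b i)).toLinearMap b hrot
    have hsum : mvfderiv I f x (V x) = ∑ i, ∑ j,
        mvfderiv I (fun y ↦ (inner ℝ (T (i, j) y) (T (i, j) y) : ℝ)) x (V x) := by
      rw [show mvfderiv I f x = _ from hfs, sum_apply, Fintype.sum_prod_type]
    rw [hsum]
    simp only [hd, Finset.sum_add_distrib, ← Finset.mul_sum, hs2]
    rw [Finset.sum_comm]
    simp [hs1]
  have hf : HasMFDerivAt I 𝓘(ℝ, ℝ) f x (0 : TangentSpace I x →L[ℝ] ℝ) := by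
    have := hfd.hasMFDerivAt
    rwa [show mfderiv I 𝓘(ℝ, ℝ) f x = (0 : TangentSpace I x →L[ℝ] ℝ) from hf0] at this
  exact hf.congr_of_eventuallyEq hfe

theorem extDerivForm_torsionForm (hcov : cov.ContMDiffCovariantDerivative ∞)
    (hmetric : IsMetric cov) (hflat : IsFlat cov) (hskew : HasSkewTorsion cov)
    {W : Fin 4 → Π x : M, TangentSpace I x} (hW : ∀ i, IsSmoothField (W i)) (x : M) :
    3 * extDerivForm (torsionForm cov) W x = 2 * sigmaForm cov x (fun i ↦ W i x) := by
  have h1 : Finset.Ici (1 : Fin 3) = {1, 2} := by decide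
  have h2 : Finset.Ici (2 : Fin 3) = {2} := by decide
  -- the directional derivatives in `dT` are expressed through `∇T` and `∇`
  have hd : ∀ i j k l, mvfderiv I (fun y ↦
      (inner ℝ (cov.torsion y (W j y) (W k y)) (W l y) : ℝ)) x (W i x) =
      (1 / 3) * sigmaForm cov x ![W j x, W k x, W l x, W i x]
      + inner ℝ (cov.torsion x (cov (W j) x (W i x)) (W k x)) (W l x)
      - inner ℝ (cov.torsion x (cov (W k) x (W i x)) (W j x)) (W l x)
      + inner ℝ (cov.torsion x (cov (W l) x (W i x)) (W j x)) (W k x) := by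
    intro i j k l
    have h3 := inner_covDerivTorsion_eq_covDeriv hcov hmetric (hW i) (hW j) (hW k) (hW l) x
    rw [hflat.inner_covDerivTorsion hcov hmetric hskew (hW i) (hW j) (hW k) (hW l),
      covDeriv_torsionForm] at h3
    simp only [Matrix.cons_val] at h3
    rw [inner_torsion_antisymm x (W j x) (cov (W k) x (W i x)),
      ← hskew.inner_rotate x (cov (W l) x (W i x))] at h3
    linarith
  -- the bracket terms: `[Wᵢ, Wⱼ] = ∇_{Wᵢ} Wⱼ - ∇_{Wⱼ} Wᵢ - T(Wᵢ, Wⱼ)`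
  have hb : ∀ i j k l, (inner ℝ (cov.torsion x
      (VectorField.mlieBracket I (W i) (W j) x) (W k x)) (W l x) : ℝ) =
      inner ℝ (cov.torsion x (cov (W j) x (W i x)) (W k x)) (W l x)
      - inner ℝ (cov.torsion x (cov (W i) x (W j x)) (W k x)) (W l x)
      - inner ℝ (cov.torsion x (W i x) (W j x)) (cov.torsion x (W k x) (W l x)) := by
    intro i j k l
    rw [real_inner_comm (cov.torsion x (W k x) (W l x)), ← hskew.inner_rotate x
      (cov.torsion x (W i x) (W j x)),
      torsion_apply_of_isSmoothField (hW i) (hW j)]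
    simp only [map_sub, sub_apply, inner_sub_left]
    ring
  simp [extDerivForm, torsionForm, Fin.sum_univ_four, Fin.sum_univ_three, Fin.removeNth,
    Fin.succAbove, h1, h2]
  simp only [hd, hb, sigmaForm, Matrix.cons_val]
  rw [cov.torsion_antisymm (W 1 x) (W 0 x), cov.torsion_antisymm (W 2 x) (W 0 x),
    cov.torsion_antisymm (W 2 x) (W 1 x), cov.torsion_antisymm (W 3 x) (W 0 x),
    cov.torsion_antisymm (W 3 x) (W 1 x), cov.torsion_antisymm (W 3 x) (W 2 x)]
  simp only [inner_neg_left, inner_neg_right]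
  rw [real_inner_comm (cov.torsion x (W 0 x) (W 1 x)) (cov.torsion x (W 2 x) (W 3 x)),
    real_inner_comm (cov.torsion x (W 0 x) (W 2 x)) (cov.torsion x (W 1 x) (W 3 x)),
    real_inner_comm (cov.torsion x (W 0 x) (W 3 x)) (cov.torsion x (W 1 x) (W 2 x))]
  ring

end Invariants

/-! ### The Levi-Civita connection and the constancy of `‖T‖` -/

section Consequences

variable {E : Type*} [NormedAddCommGroup E] [NormedSpace ℝ E] [FiniteDimensional ℝ E]
  {H : Type*} [TopologicalSpace H] {I : ModelWithCorners ℝ E H}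
  {M : Type*} [TopologicalSpace M] [ChartedSpace H M] [IsManifold I ∞ M]
  [RiemannianBundle (fun x : M ↦ TangentSpace I x)]
  {cov cov' : CovariantDerivative I E (TangentSpace I : M → Type _)}

theorem sigmaForm_swap (x : M) (w : Fin 4 → TangentSpace I x) {a b : Fin 4} (hab : a ≠ b) :
    sigmaForm cov x (w ∘ Equiv.swap a b) = -sigmaForm cov x w := by
  have e10 := cov.torsion_antisymm (w 1) (w 0)
  have e20 := cov.torsion_antisymm (w 2) (w 0)
  have e21 := cov.torsion_antisymm (w 2) (w 1)
  have e30 := cov.torsion_antisymm (w 3) (w 0)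
  have e31 := cov.torsion_antisymm (w 3) (w 1)
  have e32 := cov.torsion_antisymm (w 3) (w 2)
  have c1 := real_inner_comm (cov.torsion x (w 0) (w 1)) (cov.torsion x (w 2) (w 3))
  have c2 := real_inner_comm (cov.torsion x (w 0) (w 2)) (cov.torsion x (w 1) (w 3))
  have c3 := real_inner_comm (cov.torsion x (w 0) (w 3)) (cov.torsion x (w 1) (w 2))
  have key : ∀ {a b : Fin 4}, a < b →
      sigmaForm cov x (w ∘ Equiv.swap a b) = -sigmaForm cov x w := by
    intro a b hlt
    simp only [sigmaForm, Function.comp_apply]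
    fin_cases a <;> fin_cases b <;> first
      | exact absurd hlt (by decide)
      | simp [Equiv.swap_apply_def]
        simp only [e10, e20, e21, e30, e31, e32, inner_neg_left, inner_neg_right, c1, c2, c3]
        ring
  rcases hab.lt_or_gt with h | h
  · exact key h
  · rw [Equiv.swap_comm, key h]

/-- `σ_T` is a `4`-form. -/
theorem sigmaForm_perm (x : M) (w : Fin 4 → TangentSpace I x) (τ : Equiv.Perm (Fin 4)) :
    sigmaForm cov x (w ∘ τ) = (Equiv.Perm.sign τ : ℝ) * sigmaForm cov x w := by
  induction τ using Equiv.Perm.swap_induction_on generalizing w with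
  | one => simp
  | swap_mul f a b hab ih =>
    rw [Equiv.Perm.coe_mul, ← Function.comp_assoc, ih, sigmaForm_swap x w hab,
      Equiv.Perm.sign_mul, Equiv.Perm.sign_swap hab]
    simp

theorem sigmaForm_rotate (x : M) (u v w z : TangentSpace I x) :
    sigmaForm cov x ![u, v, w, z] = -sigmaForm cov x ![z, u, v, w] := by
  have h := sigmaForm_perm (cov := cov) x ![z, u, v, w] (finRotate 4)
  rw [sign_finRotate] at h
  convert h using 1
  · congr 1
    ext i
    fin_cases i <;> rfl
  · norm_num

/-- The Levi-Civita connection is `∇ - T / 2`. -/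
theorem IsLeviCivita.isTorsionShift [T2Space M] (hmetric : IsMetric cov)
    (hskew : HasSkewTorsion cov) (h : IsLeviCivita cov') : IsTorsionShift (-(1 / 2)) cov cov' := by
  convert (h.isMetricWithScaledTorsion (cov := cov)).isTorsionShift hmetric hskew using 1
  norm_num

theorem IsMetricWithScaledTorsion.covDerivTorsion_eq_zero [T2Space M]
    (hcov : cov.ContMDiffCovariantDerivative ∞)
    (hmetric : IsMetric cov) (hflat : IsFlat cov) (hskew : HasSkewTorsion cov)
    (h : IsMetricWithScaledTorsion (1 / 3) cov cov') {V X Y : Π x : M, TangentSpace I x}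
    (hV : IsSmoothField V) (hX : IsSmoothField X) (hY : IsSmoothField Y) (x : M) :
    covDerivTorsion cov cov' V X Y x = 0 := by
  have hs := h.isTorsionShift hmetric hskew
  rw [show ((1 / 3 : ℝ) - 1) / 2 = -(1 / 3) by norm_num] at hs
  exact hs.covDerivTorsion_eq_zero hcov hmetric hflat hskew h.1 hV hX hY x

theorem IsLeviCivita.curvatureTensor_eq [T2Space M] (hcov : cov.ContMDiffCovariantDerivative ∞)
    (hmetric : IsMetric cov) (hflat : IsFlat cov) (hskew : HasSkewTorsion cov)
    (h : IsLeviCivita cov') :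
    curvatureTensor cov' = torsionQuadratic cov (-(1 / 6)) (1 / 12) (1 / 12) := by
  rw [(h.isTorsionShift hmetric hskew).curvatureTensor_eq hcov hmetric hflat hskew]
  norm_num

/-- The numerator of the sectional curvature is `‖T(u, v)‖² / 4`. -/
theorem IsLeviCivita.curvatureTensor_plane [T2Space M]
    (hcov : cov.ContMDiffCovariantDerivative ∞)
    (hmetric : IsMetric cov) (hflat : IsFlat cov) (hskew : HasSkewTorsion cov)
    (h : IsLeviCivita cov') (x : M) (u v : TangentSpace I x) :
    curvatureTensor cov' x ![u, v, v, u] = (1 / 4) * ‖cov.torsion x u v‖ ^ 2 := by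
  rw [h.curvatureTensor_eq hcov hmetric hflat hskew]
  simp only [torsionQuadratic, Matrix.cons_val, CovariantDerivative.torsion_self]
  rw [cov.torsion_antisymm v u]
  simp only [inner_neg_right, inner_neg_left, inner_zero_left, real_inner_self_eq_norm_sq]
  ring

theorem IsLeviCivita.scalarCurvature_eq [T2Space M]
    (hcov : cov.ContMDiffCovariantDerivative ∞)
    (hmetric : IsMetric cov) (hflat : IsFlat cov) (hskew : HasSkewTorsion cov)
    (h : IsLeviCivita cov') (x : M) :
    scalarCurvature cov' x = (1 / 4) * torsionNormSq cov x := by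
  simp only [scalarCurvature, torsionNormSq, h.curvatureTensor_plane hcov hmetric hflat hskew,
    Finset.mul_sum]

theorem torsionNormSq_const [T2Space M] [I.Boundaryless] [PreconnectedSpace M]
    [IsContMDiffRiemannianBundle I ∞ E (fun x : M ↦ TangentSpace I x)]
    (hcov : cov.ContMDiffCovariantDerivative ∞) (hmetric : IsMetric cov) (hflat : IsFlat cov)
    (hskew : HasSkewTorsion cov) (x y : M) : torsionNormSq cov x = torsionNormSq cov y := by
  obtain ⟨cov', -, h⟩ := exists_isMetricWithScaledTorsion hcov hmetric hskew (1 / 3)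
  exact eq_of_hasMFDerivAt_zero (hasMFDerivAt_torsionNormSq hcov hskew h.1
    fun V X Y hV hX hY ↦ h.covDerivTorsion_eq_zero hcov hmetric hflat hskew hV hX hY) x y

end Consequences

end FlatTorsion

open FlatTorsion
theorem mainTheorem3
    {E : Type*} [NormedAddCommGroup E] [NormedSpace ℝ E] [FiniteDimensional ℝ E]
    {H : Type*} [TopologicalSpace H] {I : ModelWithCorners ℝ E H} [I.Boundaryless]
    {M : Type*} [TopologicalSpace M] [ChartedSpace H M] [IsManifold I ∞ M]
    [T2Space M] [ConnectedSpace M]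
    [RiemannianBundle (fun x : M ↦ TangentSpace I x)]
    [IsContMDiffRiemannianBundle I ∞ E (fun x : M ↦ TangentSpace I x)]
    (nabla : CovariantDerivative I E (TangentSpace I : M → Type _))
    (hsmooth : nabla.ContMDiffCovariantDerivative ∞)
    (hmetric : IsMetric nabla) (hflat : IsFlat nabla) (hskew : HasSkewTorsion nabla) :
    -- the Levi-Civita connection and the metric connection with torsion `T / 3` exist
    (∃ nablaG : CovariantDerivative I E (TangentSpace I : M → Type _),
      nablaG.ContMDiffCovariantDerivative ∞ ∧ IsLeviCivita nablaG) ∧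
    (∃ nablaThird : CovariantDerivative I E (TangentSpace I : M → Type _),
      nablaThird.ContMDiffCovariantDerivative ∞ ∧
        IsMetricWithScaledTorsion (1 / 3) nabla nablaThird) ∧
    -- `3 dT = 2 σ_T`
    (∀ W : Fin 4 → Π x : M, TangentSpace I x, (∀ i, IsSmoothField (W i)) → ∀ x,
      3 * extDerivForm (torsionForm nabla) W x = 2 * sigmaForm nabla x (fun i ↦ W i x)) ∧
    -- `∇T` is a `4`-form
    (∀ (W : Fin 4 → Π x : M, TangentSpace I x) (τ : Equiv.Perm (Fin 4)),
      (∀ i, IsSmoothField (W i)) → ∀ x,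
      covDeriv nabla (torsionForm nabla) (W (τ 0)) (fun i ↦ W (τ i.succ)) x
        = (Equiv.Perm.sign τ : ℝ)
          * covDeriv nabla (torsionForm nabla) (W 0) (fun i ↦ W i.succ) x) ∧
    -- `(∇_V T)(X, Y, Z) = (1/3) σ_T(X, Y, Z, V)`
    (∀ V X Y Z : Π x : M, TangentSpace I x,
      IsSmoothField V → IsSmoothField X → IsSmoothField Y → IsSmoothField Z → ∀ x,
      covDeriv nabla (torsionForm nabla) V ![X, Y, Z] x
        = (1 / 3) * sigmaForm nabla x ![X x, Y x, Z x, V x]) ∧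
    -- `∇_V T = -(1/3) V ⌟ σ_T`
    (∀ V X Y Z : Π x : M, TangentSpace I x,
      IsSmoothField V → IsSmoothField X → IsSmoothField Y → IsSmoothField Z → ∀ x,
      covDeriv nabla (torsionForm nabla) V ![X, Y, Z] x
        = -(1 / 3) * interiorProduct V (sigmaForm nabla) x ![X x, Y x, Z x]) ∧
    -- `‖T‖` is constant
    (∀ x y, threeFormNorm (torsionForm nabla) x = threeFormNorm (torsionForm nabla) y) ∧
    -- statements about `∇^{1/3}`
    (∀ nablaThird : CovariantDerivative I E (TangentSpace I : M → Type _),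
      IsMetricWithScaledTorsion (1 / 3) nabla nablaThird →
        IsParallel nablaThird (torsionForm nabla) ∧
        IsParallel nablaThird (sigmaForm nabla)) ∧
    -- statements about the Levi-Civita connection `∇^g`
    (∀ nablaG : CovariantDerivative I E (TangentSpace I : M → Type _), IsLeviCivita nablaG →
      -- `(∇^g_V T)(X, Y, Z) = -(1/6) σ_T(X, Y, Z, V)`
      (∀ V X Y Z : Π x : M, TangentSpace I x,
        IsSmoothField V → IsSmoothField X → IsSmoothField Y → IsSmoothField Z → ∀ x,
        covDeriv nablaG (torsionForm nabla) V ![X, Y, Z] x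
          = -(1 / 6) * sigmaForm nabla x ![X x, Y x, Z x, V x]) ∧
      -- `∇^g_V T = (1/6) V ⌟ σ_T`
      (∀ V X Y Z : Π x : M, TangentSpace I x,
        IsSmoothField V → IsSmoothField X → IsSmoothField Y → IsSmoothField Z → ∀ x,
        covDeriv nablaG (torsionForm nabla) V ![X, Y, Z] x
          = (1 / 6) * interiorProduct V (sigmaForm nabla) x ![X x, Y x, Z x]) ∧
      -- the scalar curvature is constant
      (∀ x y : M, scalarCurvature nablaG x = scalarCurvature nablaG y) ∧
      -- the Riemann curvature tensor, on smooth vector fields and on tangent vectors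
      (∀ X Y Z V : Π x : M, TangentSpace I x,
        IsSmoothField X → IsSmoothField Y → IsSmoothField Z → IsSmoothField V → ∀ x,
        inner ℝ (curvature nablaG X Y Z x) (V x)
          = -(1 / 6) * inner ℝ (nabla.torsion x (X x) (Y x)) (nabla.torsion x (Z x) (V x))
            + (1 / 12) * inner ℝ (nabla.torsion x (Y x) (Z x)) (nabla.torsion x (X x) (V x))
            + (1 / 12) * inner ℝ (nabla.torsion x (Z x) (X x)) (nabla.torsion x (Y x) (V x))) ∧
      (∀ (x : M) (u v w z : TangentSpace I x),
        curvatureTensor nablaG x ![u, v, w, z]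
          = -(1 / 6) * inner ℝ (nabla.torsion x u v) (nabla.torsion x w z)
            + (1 / 12) * inner ℝ (nabla.torsion x v w) (nabla.torsion x u z)
            + (1 / 12) * inner ℝ (nabla.torsion x w u) (nabla.torsion x v z)) ∧
      -- `∇^{1/3} R^g = 0`
      (∀ nablaThird : CovariantDerivative I E (TangentSpace I : M → Type _),
        IsMetricWithScaledTorsion (1 / 3) nabla nablaThird →
          IsParallel nablaThird (curvatureTensor nablaG)) ∧
      -- the sectional curvature
      (∀ (x : M) (u v : TangentSpace I x), LinearIndependent ℝ ![u, v] →
        sectionalCurvature nablaG x u v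
          = ‖nabla.torsion x u v‖ ^ 2 / (4 * (‖u‖ ^ 2 * ‖v‖ ^ 2 - inner ℝ u v ^ 2)) ∧
        0 ≤ sectionalCurvature nablaG x u v)) := by
  have hX3 : ∀ {X Y Z : Π x : M, TangentSpace I x}, IsSmoothField X → IsSmoothField Y →
      IsSmoothField Z → ∀ i, IsSmoothField ((![X, Y, Z] : Fin 3 → Π x : M, TangentSpace I x) i) :=
    fun hX hY hZ ↦ by simp [Fin.forall_fin_succ, hX, hY, hZ]
  have hnabla : ∀ (V : Π x : M, TangentSpace I x) (X : Fin 3 → Π x : M, TangentSpace I x),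
      IsSmoothField V → (∀ i, IsSmoothField (X i)) → ∀ x,
      covDeriv nabla (torsionForm nabla) V X x =
        (1 / 3) * sigmaForm nabla x ![X 0 x, X 1 x, X 2 x, V x] := fun V X hV hX x ↦ by
    rw [isTorsionShift_zero.covDeriv_torsionForm hsmooth hmetric hflat hskew hV hX, add_zero]
  have hpar : ∀ nablaThird : CovariantDerivative I E (TangentSpace I : M → Type _),
      IsMetricWithScaledTorsion (1 / 3) nabla nablaThird → ∀ a b c,
        IsParallel nablaThird (torsionQuadratic nabla a b c) := fun nablaThird h ↦
    isParallel_torsionQuadratic hsmooth h.1 fun V X Y hV hX hY ↦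
      h.covDerivTorsion_eq_zero hsmooth hmetric hflat hskew hV hX hY
  have hint : ∀ (V X Y Z : Π x : M, TangentSpace I x) (x : M),
      sigmaForm nabla x ![X x, Y x, Z x, V x] =
        -interiorProduct V (sigmaForm nabla) x ![X x, Y x, Z x] := fun V X Y Z x ↦
    sigmaForm_rotate x _ _ _ _
  refine ⟨?_, exists_isMetricWithScaledTorsion hsmooth hmetric hskew (1 / 3),
    fun W hW x ↦ extDerivForm_torsionForm hsmooth hmetric hflat hskew hW x, ?_, ?_, ?_, ?_, ?_, ?_⟩
  · obtain ⟨nablaG, hG, hG'⟩ := exists_isMetricWithScaledTorsion hsmooth hmetric hskew 0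
    exact ⟨nablaG, hG, hG'.1, fun x ↦ (hG'.2 x).trans (zero_smul ℝ (nabla.torsion x))⟩
  · intro W τ hW x
    have h4 : ∀ w : Fin 4 → TangentSpace I x,
        sigmaForm nabla x ![w 1, w 2, w 3, w 0] = -sigmaForm nabla x w := by
      intro w
      rw [sigmaForm_rotate]
      congr 2
      ext i
      fin_cases i <;> rfl
    rw [hnabla _ _ (hW _) (fun i ↦ hW _), hnabla _ _ (hW _) (fun i ↦ hW _)]
    have h5 := h4 (fun i ↦ W i x)
    have h6 := h4 ((fun i ↦ W i x) ∘ τ)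
    rw [sigmaForm_perm] at h6
    simp only [Function.comp_apply] at h6
    simp only [Fin.succ_zero_eq_one, Fin.succ_one_eq_two, show Fin.succ (2 : Fin 3) = 3 from rfl]
    rw [h5, h6]
    ring
  · exact fun V X Y Z hV hX hY hZ x ↦ hnabla V _ hV (hX3 hX hY hZ) x
  · intro V X Y Z hV hX hY hZ x
    rw [hnabla V _ hV (hX3 hX hY hZ) x]
    simp only [Matrix.cons_val]
    rw [hint]
    ring
  · intro x y
    rw [threeFormNorm_torsionForm, threeFormNorm_torsionForm,
      torsionNormSq_const hsmooth hmetric hflat hskew x y]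
  · intro nablaThird h
    refine ⟨fun V X hV hX x ↦ ?_, by
      rw [sigmaForm_eq_torsionQuadratic]; exact hpar nablaThird h 1 1 1⟩
    rw [covDeriv_torsionForm_eq_inner hsmooth h.1 hV hX,
      h.covDerivTorsion_eq_zero hsmooth hmetric hflat hskew hV (hX 0) (hX 1), inner_zero_left]
  · intro nablaG hG
    have hshift := hG.isTorsionShift hmetric hskew
    have hR := hG.curvatureTensor_eq hsmooth hmetric hflat hskew
    have hGT : ∀ V X Y Z : Π x : M, TangentSpace I x,
        IsSmoothField V → IsSmoothField X → IsSmoothField Y → IsSmoothField Z → ∀ x,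
        covDeriv nablaG (torsionForm nabla) V ![X, Y, Z] x
          = -(1 / 6) * sigmaForm nabla x ![X x, Y x, Z x, V x] := by
      intro V X Y Z hV hX hY hZ x
      rw [hshift.covDeriv_torsionForm hsmooth hmetric hflat hskew hV (hX3 hX hY hZ)]
      simp only [Matrix.cons_val]
      norm_num
    refine ⟨hGT, ?_, ?_, ?_, ?_, ?_, ?_⟩
    · intro V X Y Z hV hX hY hZ x
      rw [hGT V X Y Z hV hX hY hZ x, hint]
      ring
    · intro x y
      rw [hG.scalarCurvature_eq hsmooth hmetric hflat hskew,
        hG.scalarCurvature_eq hsmooth hmetric hflat hskew,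
        torsionNormSq_const hsmooth hmetric hflat hskew x y]
    · intro X Y Z V hX hY hZ hV x
      rw [hshift.inner_curvature hsmooth hmetric hflat hskew hX hY hZ hV]
      simp only [torsionQuadratic, Matrix.cons_val]
      norm_num
    · intro x u v w z
      rw [hR]
      simp only [torsionQuadratic, Matrix.cons_val]
    · intro nablaThird h
      rw [hR]
      exact hpar nablaThird h _ _ _
    · intro x u v _
      have hK : sectionalCurvature nablaG x u v =
          ‖nabla.torsion x u v‖ ^ 2 / (4 * (‖u‖ ^ 2 * ‖v‖ ^ 2 - inner ℝ u v ^ 2)) := by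
        rw [sectionalCurvature, hG.curvatureTensor_plane hsmooth hmetric hflat hskew,
          mul_comm (1 / 4 : ℝ), mul_one_div, div_div]
      have hcs : (inner ℝ u v : ℝ) ^ 2 ≤ ‖u‖ ^ 2 * ‖v‖ ^ 2 := by
        rw [← mul_pow, ← sq_abs]
        exact pow_le_pow_left₀ (abs_nonneg _) (abs_real_inner_le_norm u v) 2
      refine ⟨hK, ?_⟩
      rw [hK]
      have := sub_nonneg.2 hcs
      positivity
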